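/- Let $a>b>0$. Let $P^6\subset\mathbf R^9(\boldsymbol\omega,\boldsymbol\alpha,\boldsymbol\beta)$ be given by $|\boldsymbol\alpha|=a$, $|\boldsymbol\beta|=b$, $\boldsymbol\alpha\cdot\boldsymbol\beta=0$, and consider on it the equations of the Kowalevski top in two constant fields $$2\dot\omega_1=\omega_2\omega_3+\beta_3,\quad 2\dot\omega_2=-\omega_1\omega_3-\alpha_3,\quad \dot\omega_3=\alpha_2-\beta_1,\quad \dot{\boldsymbol\alpha}=\boldsymbol\alpha\times\boldsymbol\omega,\quad \dot{\boldsymbol\beta}=\boldsymbol\beta\times\boldsymbol\omega .$$ Put $x_{1,2}=(\alpha_1-\beta_2)\pm i(\alpha_2+\beta_1)$, $y_{1,2}=(\alpha_1+\beta_2)\pm i(\alpha_2-\beta_1)$, $z_{1,2}=\alpha_3\pm i\beta_3$, $w_{1,2}=\omega_1\pm i\omega_2$, $w_3=\omega_3$ and $$R_1=\frac{w_2x_1+w_1y_2+w_3z_1}{w_1}-\frac{w_1x_2+w_2y_1+w_3z_2}{w_2},$$ $$R_2=(w_2z_1+w_1z_2)w_3^2+\Bigl[\frac{w_2z_1^2}{w_1}+\frac{w_1z_2^2}{w_2}+w_1w_2(y_1+y_2)+x_1w_2^2+x_2w_1^2\Bigr]w_3+\frac{w_2^2x_1z_1}{w_1}+\frac{w_1^2x_2z_2}{w_2}+x_1z_2w_2+x_2z_1w_1+(w_1z_2-w_2z_1)(y_1-y_2).$$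 With $M_1=2\omega_1$, $M_2=2\omega_2$, $M_\alpha=2\omega_1\alpha_1+2\omega_2\alpha_2+\omega_3\alpha_3$, $M_\beta=2\omega_1\beta_1+2\omega_2\beta_2+\omega_3\beta_3$, $M_\gamma=2\omega_1(\alpha_2\beta_3-\alpha_3\beta_2)+2\omega_2(\alpha_3\beta_1-\alpha_1\beta_3)+\omega_3(\alpha_1\beta_2-\alpha_2\beta_1)$ let $$S=-\frac{M_\alpha M_1+M_\beta M_2}{M_1^2+M_2^2},\qquad \mathrm T=\tfrac12(M_\alpha M_1+M_\beta M_2)-2(\alpha_1\beta_2-\alpha_2\beta_1)+a^2+b^2 ,$$ and let $$H=\omega_1^2+\omega_2^2+\tfrac12\omega_3^2-(\alpha_1+\beta_2),\quad K=(\omega_1^2-\omega_2^2+\alpha_1-\beta_2)^2+(2\omega_1\omega_2+\alpha_2+\beta_1)^2,\quad G=\tfrac14(M_\alpha^2+M_\beta^2)+\tfrac12\omega_3M_\gamma-b^2\alpha_1-a^2\beta_2$$ be the general first integrals. A *regular motion on $\mathfrak O$ with constants $(s,\tau)$* is a solution in $P^6$, defined for all times, along which $w_1$ does not vanish identically and $R_1=R_2=0$,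 $S=s$, $\mathrm T=\tau$ whenever $w_1\ne0$. A *pendulum motion on $\mathfrak O$ with constants $(s,\tau)$* is a solution in $P^6$, defined for all times, with $w_1\equiv0$, $z_1\equiv0$ (where $S$ is undefined) such that $s\neq0$ and $$H=\frac{a^2+b^2-\tau}{2s}+s,\quad K=\frac{\tau^2-2(a^2+b^2)\tau+(a^2-b^2)^2}{4s^2}+\tau,\quad G=\frac{a^2b^2}{s}+\frac12(a^2+b^2-\tau)s .$$ **Theorem.** (i) A motion on $\mathfrak O$ (regular or pendulum) with constants $(s,\tau)$ exists if and only if $(s,\tau)$ satisfies one of the following: 1. $-a\le s\le-b$, $\tau\ge(a-b)^2$; 2. $-b\le s<0$, $\tau\ge(\sqrt{a^2-s^2}+\sqrt{b^2-s^2})^2$; 3. $0<s\le b$, $\tau\le(\sqrt{a^2-s^2}-\sqrt{b^2-s^2})^2$; 4. $b\le s\le a$, $\tau\le(a+b)^2$; 5. $s\ge a$, $-(\sqrt{s^2-b^2}-\sqrt{s^2-a^2})^2\le\tau\le(a+b)^2$. Equivalently, these are the $(s,\tau)$ for which the integral manifold is non-empty, that is, for which there is a point of $P^6$ with $w_1\ne0$,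 $R_1=R_2=0$, $S=s$, $\mathrm T=\tau$, or one with $w_1=z_1=0$, $s\ne0$ and the above values of $H,K,G$. (ii) A regular motion on $\mathfrak O$ with constants $(s,\tau)$ exists if and only if $(s,\tau)$ lies in this region but not on the two boundary edges $\{-a\le s\le-b,\ \tau=(a-b)^2\}$ and $\{s\ge b,\ \tau=(a+b)^2\}$; the same set is the image of $J=S\times\mathrm T$ on $\{w_1\neq0,\ R_1=R_2=0\}\subset P^6$. -/

import Mathlib

noncomputable section

namespace KowalevskiTop

/-- A point `(ω, α, β)` of `ℝ⁹`: the angular velocity and the two field vectors, in the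
principal axes of inertia. -/
structure State where
  ω₁ : ℝ
  ω₂ : ℝ
  ω₃ : ℝ
  α₁ : ℝ
  α₂ : ℝ
  α₃ : ℝ
  β₁ : ℝ
  β₂ : ℝ
  β₃ : ℝ

/-- The phase space `P⁶`: `|α| = a`, `|β| = b`, `α ⊥ β`. -/
def phaseSpace (a b : ℝ) : Set State :=
  {q | q.α₁ ^ 2 + q.α₂ ^ 2 + q.α₃ ^ 2 = a ^ 2 ∧
       q.β₁ ^ 2 + q.β₂ ^ 2 + q.β₃ ^ 2 = b ^ 2 ∧
       q.α₁ * q.β₁ + q.α₂ * q.β₂ + q.α₃ * q.β₃ = 0}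

/-- `ζ` is a solution, for all times, of the Euler–Poisson equations of the Kowalevski top
in two constant fields. -/
structure IsSolution (ζ : ℝ → State) : Prop where
  hω₁ : ∀ t, HasDerivAt (fun u => (ζ u).ω₁) (((ζ t).ω₂ * (ζ t).ω₃ + (ζ t).β₃) / 2) t
  hω₂ : ∀ t, HasDerivAt (fun u => (ζ u).ω₂) ((-(ζ t).ω₁ * (ζ t).ω₃ - (ζ t).α₃) / 2) t
  hω₃ : ∀ t, HasDerivAt (fun u => (ζ u).ω₃) ((ζ t).α₂ - (ζ t).β₁) t
  hα₁ : ∀ t, HasDerivAt (fun u => (ζ u).α₁) ((ζ t).α₂ * (ζ t).ω₃ - (ζ t).α₃ * (ζ t).ω₂) t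
  hα₂ : ∀ t, HasDerivAt (fun u => (ζ u).α₂) ((ζ t).α₃ * (ζ t).ω₁ - (ζ t).α₁ * (ζ t).ω₃) t
  hα₃ : ∀ t, HasDerivAt (fun u => (ζ u).α₃) ((ζ t).α₁ * (ζ t).ω₂ - (ζ t).α₂ * (ζ t).ω₁) t
  hβ₁ : ∀ t, HasDerivAt (fun u => (ζ u).β₁) ((ζ t).β₂ * (ζ t).ω₃ - (ζ t).β₃ * (ζ t).ω₂) t
  hβ₂ : ∀ t, HasDerivAt (fun u => (ζ u).β₂) ((ζ t).β₃ * (ζ t).ω₁ - (ζ t).β₁ * (ζ t).ω₃) t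
  hβ₃ : ∀ t, HasDerivAt (fun u => (ζ u).β₃) ((ζ t).β₁ * (ζ t).ω₂ - (ζ t).β₂ * (ζ t).ω₁) t

/-- A motion of the top: a solution, defined for all times, in the phase space `P⁶`. -/
def IsMotion (a b : ℝ) (ζ : ℝ → State) : Prop :=
  IsSolution ζ ∧ ∀ t, ζ t ∈ phaseSpace a b

namespace State

variable (q : State)

/-! The components of the kinetic momentum `M = Iω`, `I = diag(2, 2, 1)`, along `e₁`, `e₂`,
`α`, `β`, `α × β`. -/

def M₁ : ℝ := 2 * q.ω₁

def M₂ : ℝ := 2 * q.ω₂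

def Mα : ℝ := 2 * q.ω₁ * q.α₁ + 2 * q.ω₂ * q.α₂ + q.ω₃ * q.α₃

def Mβ : ℝ := 2 * q.ω₁ * q.β₁ + 2 * q.ω₂ * q.β₂ + q.ω₃ * q.β₃

def Mγ : ℝ :=
  2 * q.ω₁ * (q.α₂ * q.β₃ - q.α₃ * q.β₂) + 2 * q.ω₂ * (q.α₃ * q.β₁ - q.α₁ * q.β₃) +
    q.ω₃ * (q.α₁ * q.β₂ - q.α₂ * q.β₁)

/-! The three general first integrals. -/

def H : ℝ := q.ω₁ ^ 2 + q.ω₂ ^ 2 + (1 / 2) * q.ω₃ ^ 2 - (q.α₁ + q.β₂)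

def K : ℝ :=
  (q.ω₁ ^ 2 - q.ω₂ ^ 2 + q.α₁ - q.β₂) ^ 2 + (2 * q.ω₁ * q.ω₂ + q.α₂ + q.β₁) ^ 2

def G (a b : ℝ) : ℝ :=
  (1 / 4) * (q.Mα ^ 2 + q.Mβ ^ 2) + (1 / 2) * q.ω₃ * q.Mγ - b ^ 2 * q.α₁ - a ^ 2 * q.β₂

/-! The complex phase variables. -/

def x₁ : ℂ := ((q.α₁ - q.β₂ : ℝ) : ℂ) + Complex.I * ((q.α₂ + q.β₁ : ℝ) : ℂ)

def x₂ : ℂ := ((q.α₁ - q.β₂ : ℝ) : ℂ) - Complex.I * ((q.α₂ + q.β₁ : ℝ) : ℂ)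

def y₁ : ℂ := ((q.α₁ + q.β₂ : ℝ) : ℂ) + Complex.I * ((q.α₂ - q.β₁ : ℝ) : ℂ)

def y₂ : ℂ := ((q.α₁ + q.β₂ : ℝ) : ℂ) - Complex.I * ((q.α₂ - q.β₁ : ℝ) : ℂ)

def z₁ : ℂ := (q.α₃ : ℂ) + Complex.I * (q.β₃ : ℂ)

def z₂ : ℂ := (q.α₃ : ℂ) - Complex.I * (q.β₃ : ℂ)

def w₁ : ℂ := (q.ω₁ : ℂ) + Complex.I * (q.ω₂ : ℂ)

def w₂ : ℂ := (q.ω₁ : ℂ) - Complex.I * (q.ω₂ : ℂ)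

def w₃ : ℂ := (q.ω₃ : ℂ)

/-! The functions whose common zero set is the invariant set `𝔒` (away from its pendulum
motions). They are meaningful where `w₁ ≠ 0`, equivalently `w₂ ≠ 0`, and are only used
there. -/

def R₁ : ℂ :=
  (q.w₂ * q.x₁ + q.w₁ * q.y₂ + q.w₃ * q.z₁) / q.w₁ -
    (q.w₁ * q.x₂ + q.w₂ * q.y₁ + q.w₃ * q.z₂) / q.w₂

def R₂ : ℂ :=
  (q.w₂ * q.z₁ + q.w₁ * q.z₂) * q.w₃ ^ 2 +
    (q.w₂ * q.z₁ ^ 2 / q.w₁ + q.w₁ * q.z₂ ^ 2 / q.w₂ + q.w₁ * q.w₂ * (q.y₁ + q.y₂) +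
      q.x₁ * q.w₂ ^ 2 + q.x₂ * q.w₁ ^ 2) * q.w₃ +
    q.w₂ ^ 2 * q.x₁ * q.z₁ / q.w₁ + q.w₁ ^ 2 * q.x₂ * q.z₂ / q.w₂ +
    q.x₁ * q.z₂ * q.w₂ + q.x₂ * q.z₁ * q.w₁ +
    (q.w₁ * q.z₂ - q.w₂ * q.z₁) * (q.y₁ - q.y₂)

/-! The partial integrals; `S` is meaningful where `w₁ ≠ 0` and is only used there. -/

def S : ℝ := -((q.Mα * q.M₁ + q.Mβ * q.M₂) / (q.M₁ ^ 2 + q.M₂ ^ 2))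

def T (a b : ℝ) : ℝ :=
  (1 / 2) * (q.Mα * q.M₁ + q.Mβ * q.M₂) - 2 * (q.α₁ * q.β₂ - q.α₂ * q.β₁) + a ^ 2 + b ^ 2

end State

/-- The part of the invariant set `𝔒` where `w₁ ≠ 0`. -/
def regularPart (a b : ℝ) : Set State :=
  {q | q ∈ phaseSpace a b ∧ q.w₁ ≠ 0 ∧ q.R₁ = 0 ∧ q.R₂ = 0}

/-- The integral map `J = S × T`. -/
def J (a b : ℝ) (q : State) : ℝ × ℝ := (q.S, q.T a b)

/-- The pendulum points of `𝔒` belonging to the constants `(s, τ)`: there `w₁ = 0`, `z₁ = 0`,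
`S` is not defined, and `(s, τ)` is attached to the point through the expressions of the
general integrals `H`, `K`, `G` on `𝔒` in terms of `s`, `τ`. -/
def pendulumPart (a b s τ : ℝ) : Set State :=
  {q | q ∈ phaseSpace a b ∧ q.w₁ = 0 ∧ q.z₁ = 0 ∧ s ≠ 0 ∧
    q.H = (a ^ 2 + b ^ 2 - τ) / (2 * s) + s ∧
    q.K = (τ ^ 2 - 2 * (a ^ 2 + b ^ 2) * τ + (a ^ 2 - b ^ 2) ^ 2) / (4 * s ^ 2) + τ ∧
    q.G a b = ((a ^ 2 + b ^ 2) ^ 2 - (a ^ 2 - b ^ 2) ^ 2) / (4 * s) +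
      (1 / 2) * (a ^ 2 + b ^ 2 - τ) * s}

/-- The points of `𝔒` with the constants `(s, τ)` of the partial integrals. -/
def integralManifold (a b s τ : ℝ) : Set State :=
  {q | q ∈ regularPart a b ∧ J a b q = (s, τ)} ∪ pendulumPart a b s τ

/-- A motion on `𝔒`, different from the pendulum motions, with the constants `(s, τ)`:
`w₁` does not vanish identically, and `R₁ = R₂ = 0`, `S = s`, `T = τ` whenever `w₁ ≠ 0`. -/
def IsRegularMotion (a b s τ : ℝ) (ζ : ℝ → State) : Prop :=
  IsMotion a b ζ ∧ (∃ t, (ζ t).w₁ ≠ 0) ∧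
    ∀ t, (ζ t).w₁ ≠ 0 → ζ t ∈ regularPart a b ∧ J a b (ζ t) = (s, τ)

/-- A pendulum motion with the constants `(s, τ)`. -/
def IsPendulumMotion (a b s τ : ℝ) (ζ : ℝ → State) : Prop :=
  IsMotion a b ζ ∧ ∀ t, ζ t ∈ pendulumPart a b s τ

/-! The five regions. -/

def region₁ (a b : ℝ) : Set (ℝ × ℝ) :=
  {p | -a ≤ p.1 ∧ p.1 ≤ -b ∧ (a - b) ^ 2 ≤ p.2}

def region₂ (a b : ℝ) : Set (ℝ × ℝ) :=
  {p | -b ≤ p.1 ∧ p.1 < 0 ∧ (√(a ^ 2 - p.1 ^ 2) + √(b ^ 2 - p.1 ^ 2)) ^ 2 ≤ p.2}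

def region₃ (a b : ℝ) : Set (ℝ × ℝ) :=
  {p | 0 < p.1 ∧ p.1 ≤ b ∧ p.2 ≤ (√(a ^ 2 - p.1 ^ 2) - √(b ^ 2 - p.1 ^ 2)) ^ 2}

def region₄ (a b : ℝ) : Set (ℝ × ℝ) :=
  {p | b ≤ p.1 ∧ p.1 ≤ a ∧ p.2 ≤ (a + b) ^ 2}

def region₅ (a b : ℝ) : Set (ℝ × ℝ) :=
  {p | a ≤ p.1 ∧ -(√(p.1 ^ 2 - b ^ 2) - √(p.1 ^ 2 - a ^ 2)) ^ 2 ≤ p.2 ∧ p.2 ≤ (a + b) ^ 2}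

/-- The admissible region. -/
def admissibleRegion (a b : ℝ) : Set (ℝ × ℝ) :=
  region₁ a b ∪ region₂ a b ∪ region₃ a b ∪ region₄ a b ∪ region₅ a b

/-- The two boundary edges of the admissible region over which all motions are pendulum
motions. -/
def pendulumEdges (a b : ℝ) : Set (ℝ × ℝ) :=
  {p | -a ≤ p.1 ∧ p.1 ≤ -b ∧ p.2 = (a - b) ^ 2} ∪ {p | b ≤ p.1 ∧ p.2 = (a + b) ^ 2}

end KowalevskiTop

end

/-!
The proof replaces `R₁ = R₂ = 0`, `S = s`, `T = τ` by polynomial equations and then solves a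
problem of plane geometry.

*Polynomial form.* With `M = Iω` and `γ = α × β`, the equations `R₁ = 0` and `S = s` say
`M·α = -s M₁` and `M·β = -s M₂`. Differentiating these along the flow gives
`γ₁ = s (ω₁ω₃ + α₃)` and `γ₂ = s (ω₂ω₃ + β₃)`, and `T = τ` becomes
`|x₁|² + |z₁|² = τ + 2 s |w₁|²`. These five equations (`State.defect`) are equivalent to the
original ones where `w₁ ≠ 0` (`regular_iff_defect`). They imply
`2 s (H - s) = a² + b² - τ` and a formula for `K` (`integrals_of_defect`), and on that energy level
the time derivative of the five left-hand sides is linear homogeneous in them. By uniqueness for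
linear systems their common zero set is invariant (`IsMotion.defect_invariant`), even across the
instants where `w₁ = 0`. Since the energy bounds `ω`, all motions exist for all times
(`exists_motion`), so that motions exist exactly where points exist.

*Necessity.* Put `x = |x₁|` and `σ = |x₁|² + |z₁|² = τ + 2 s |w₁|²`. The equations
of `P⁶` confine `(x, σ)` to a triangle (`inTriangle_of_mem`). Since `K = |w₁² + x₁|²`, the numbers
`√K`, `x`, `|w₁|²` are the sides of a triangle, which cuts out a half-strip of the `(x, σ)`-plane
with the slopes `± 2 s`. Whether the half-strip meets the triangle is decided by the positions of the three
vertices, where `(σ - τ - 2 s x)² - 4 s² K` factors (`vertexA_sq`, `vertexB_sq`, `vertexC_sq`); the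
result is `InTriangle.mem_admissibleRegion`.

*Existence of points.* Over the regions with `b ≤ |s| ≤ a` there are points with `α` and `β` in the
plane of `e₁`, `e₂` (`exists_point_planar`). Over the others the intersection of a side of the
triangle with a side of the strip gives points with `α` along `e₁` or `β` along `e₂`
(`exists_point_axis₁`, `exists_point_axis₂`).

*Pendulum points.* There `γ₃ = ± a b`, `K = a² + b² - 2 γ₃` and `G = γ₃ H`. The prescribed values of
`K` and `G` force `τ = (a ∓ b)²`, the one of `H` is then `s ± a b / s`, and the bound
`H ≥ -(a ± b)` yields the range of `s`.
-/

namespace KowalevskiTop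

/-! ### Ordinary differential equations -/

/-- Picard–Lindelöf on `[-T, T]` for all `T` at once: a bounded Lipschitz vector field is
complete. -/
theorem exists_global_solution {E : Type*} [NormedAddCommGroup E] [NormedSpace ℝ E]
    [CompleteSpace E] {F : E → E} {K : NNReal} (hK : LipschitzWith K F) {L : ℝ}
    (hL : ∀ x, ‖F x‖ ≤ L) (x₀ : E) :
    ∃ γ : ℝ → E, γ 0 = x₀ ∧ ∀ t, HasDerivAt γ (F (γ t)) t := by
  have hL0 : 0 ≤ L := (norm_nonneg _).trans (hL x₀)
  have local_sol : ∀ T : ℝ, 0 < T → ∃ γ : ℝ → E, γ 0 = x₀ ∧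
      ∀ t ∈ Set.Ioo (-T) T, HasDerivAt γ (F (γ t)) t := by
    intro T hT
    have h0 : (0 : ℝ) ∈ Set.Icc (-T) T := ⟨by linarith, hT.le⟩
    have hpl : IsPicardLindelof (fun _ => F) (⟨0, h0⟩ : Set.Icc (-T) T) x₀
        (⟨L * T, by positivity⟩ : NNReal) 0 ⟨L, hL0⟩ K :=
      IsPicardLindelof.of_time_independent (fun x _ => hL x) hK.lipschitzOnWith
        (by simp only [sub_zero, zero_sub, neg_neg, max_self, NNReal.coe_zero]; exact le_rfl)
    obtain ⟨γ, h1, h2⟩ := hpl.exists_eq_forall_mem_Icc_hasDerivWithinAt₀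
    exact ⟨γ, h1, fun t ht => (h2 t (Set.Ioo_subset_Icc_self ht)).hasDerivAt
      (Icc_mem_nhds ht.1 ht.2)⟩
  choose! g hg0 hg using local_sol
  have agree : ∀ T T' : ℝ, 0 < T → T ≤ T' → Set.EqOn (g T) (g T') (Set.Ioo (-T) T) := by
    intro T T' hT hTT'
    refine ODE_solution_unique_of_mem_Ioo (v := fun _ => F) (s := fun _ => Set.univ) (t₀ := 0)
      (fun _ _ => hK.lipschitzOnWith) ⟨by linarith, hT⟩ (fun t ht => ⟨hg T hT t ht, trivial⟩)
      (fun t ht => ⟨hg T' (by linarith) t ⟨by linarith [ht.1], by linarith [ht.2]⟩, trivial⟩) ?_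
    rw [hg0 T hT, hg0 T' (by linarith)]
  refine ⟨fun t => g (|t| + 1) t, hg0 _ (by positivity), fun t => ?_⟩
  have hmem : t ∈ Set.Ioo (-(|t| + 1)) (|t| + 1) :=
    ⟨by linarith [neg_abs_le t], by linarith [le_abs_self t]⟩
  have hmem2 : t ∈ Set.Ioo (-(|t| + 2)) (|t| + 2) :=
    ⟨by linarith [neg_abs_le t], by linarith [le_abs_self t]⟩
  have hder := hg (|t| + 2) (by positivity) t hmem2
  have heq : (fun u => g (|u| + 1) u) =ᶠ[nhds t] g (|t| + 2) := by
    have hnear : ∀ᶠ u in nhds t, |u| < |t| + 1 :=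
      (continuous_abs.tendsto t).eventually (gt_mem_nhds (by linarith))
    filter_upwards [hnear] with u hu
    exact agree _ _ (by positivity) (by linarith)
      ⟨by linarith [neg_abs_le u], by linarith [le_abs_self u]⟩
  have h := hder.congr_of_eventuallyEq heq
  rwa [← heq.self_of_nhds] at h

/-- A solution of a homogeneous linear system with continuous coefficients that vanishes at one
instant vanishes identically. -/
theorem linear_system_eq_zero {n : ℕ} {A : ℝ → Matrix (Fin n) (Fin n) ℝ}
    (hA : ∀ i j, Continuous fun t => A t i j) {e : ℝ → Fin n → ℝ}
    (he : ∀ i t, HasDerivAt (fun u => e u i) ((A t).mulVec (e t) i) t) {t₀ : ℝ} (h0 : e t₀ = 0)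
    (t : ℝ) : e t = 0 := by
  have hcont : Continuous fun t => ∑ i, ∑ j, |A t i j| :=
    continuous_finsetSum _ fun i _ => continuous_finsetSum _ fun j _ => (hA i j).abs
  set T := |t| + |t₀| + 1 with hT
  obtain ⟨C, hC⟩ := (isCompact_Icc (a := -T) (b := T)).exists_bound_of_continuousOn
    hcont.continuousOn
  have hC0 : 0 ≤ C := (norm_nonneg _).trans (hC t₀ ⟨by
    rw [hT]; linarith [neg_abs_le t₀, abs_nonneg t],
    by rw [hT]; linarith [le_abs_self t₀, abs_nonneg t]⟩)
  have hlip : ∀ u ∈ Set.Ioo (-T) T,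
      LipschitzOnWith ⟨C, hC0⟩ (fun x => (A u).mulVec x) Set.univ := by
    intro u hu
    refine LipschitzOnWith.of_dist_le_mul fun x _ y _ => ?_
    rw [dist_eq_norm, dist_eq_norm, ← Matrix.mulVec_sub]
    refine (pi_norm_le_iff_of_nonneg (by positivity)).2 fun i => ?_
    calc ‖(A u).mulVec (x - y) i‖ ≤ ∑ j, ‖A u i j * (x - y) j‖ := by
          rw [Matrix.mulVec, dotProduct]; exact norm_sum_le _ _
      _ ≤ ∑ j, |A u i j| * ‖x - y‖ := by
        refine Finset.sum_le_sum fun j _ => ?_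
        rw [norm_mul]
        exact mul_le_mul_of_nonneg_left (norm_le_pi_norm _ j) (abs_nonneg _)
      _ = (∑ j, |A u i j|) * ‖x - y‖ := by rw [Finset.sum_mul]
      _ ≤ C * ‖x - y‖ := by
        refine mul_le_mul_of_nonneg_right ?_ (norm_nonneg _)
        refine le_trans ?_ ((le_abs_self _).trans (hC u (Set.Ioo_subset_Icc_self hu)))
        exact Finset.single_le_sum (f := fun i => ∑ j, |A u i j|)
          (fun i _ => Finset.sum_nonneg fun j _ => abs_nonneg _) (Finset.mem_univ i)
  have hder : ∀ u, HasDerivAt e ((A u).mulVec (e u)) u := fun u => hasDerivAt_pi.2 fun i => he i u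
  have key := ODE_solution_unique_of_mem_Ioo (v := fun u x => (A u).mulVec x)
    (s := fun _ => Set.univ) (f := e) (g := fun _ => 0) (t₀ := t₀) hlip
    ⟨by rw [hT]; linarith [neg_abs_le t₀, abs_nonneg t],
      by rw [hT]; linarith [le_abs_self t₀, abs_nonneg t]⟩
    (fun u _ => ⟨hder u, trivial⟩)
    (fun u _ => ⟨by simpa using hasDerivAt_const u (0 : Fin n → ℝ), trivial⟩) h0
  exact key ⟨by rw [hT]; linarith [neg_abs_le t, abs_nonneg t₀],
      by rw [hT]; linarith [le_abs_self t, abs_nonneg t₀]⟩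

/-! ### The flow -/

/-- The state with the coordinates `v`, in the order `ω, α, β`. -/
def State.ofVec (v : Fin 9 → ℝ) : State := ⟨v 0, v 1, v 2, v 3, v 4, v 5, v 6, v 7, v 8⟩

/-- The right-hand side of the Euler–Poisson equations, as a vector field on `ℝ⁹`. -/
noncomputable def eulerPoisson (v : Fin 9 → ℝ) : Fin 9 → ℝ :=
  ![(v 1 * v 2 + v 8) / 2, (-v 0 * v 2 - v 5) / 2, v 4 - v 6,
    v 4 * v 2 - v 5 * v 1, v 5 * v 0 - v 3 * v 2, v 3 * v 1 - v 4 * v 0,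
    v 7 * v 2 - v 8 * v 1, v 8 * v 0 - v 6 * v 2, v 6 * v 1 - v 7 * v 0]

theorem contDiff_eulerPoisson : ContDiff ℝ 1 eulerPoisson := by
  rw [contDiff_pi]
  intro i
  fin_cases i <;> simp [eulerPoisson] <;> fun_prop

theorem eq_of_hasDerivAt_zero {f : ℝ → ℝ} (hf : ∀ t, HasDerivAt f 0 t) (t u : ℝ) : f t = f u :=
  is_const_of_deriv_eq_zero (fun t => (hf t).differentiableAt) (fun t => (hf t).deriv) t u

theorem abs_le_of_sum_sq_eq {x y z r : ℝ} (hr : 0 ≤ r) (h : x ^ 2 + y ^ 2 + z ^ 2 = r ^ 2) :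
    |x| ≤ r ∧ |y| ≤ r ∧ |z| ≤ r := by
  refine ⟨abs_le_of_sq_le_sq ?_ hr, abs_le_of_sq_le_sq ?_ hr, abs_le_of_sq_le_sq ?_ hr⟩ <;>
    linarith [sq_nonneg x, sq_nonneg y, sq_nonneg z]

/-- Every point of `P⁶` lies on a motion. The Euler–Poisson field is multiplied by a cutoff
function; this only reparametrizes the time, so the energy and the Casimir functions are still
conserved, and they keep the trajectory where the cutoff function is `1`. -/
theorem exists_motion {a b : ℝ} (ha : 0 ≤ a) (hb : 0 ≤ b) {q : State}
    (hq : q ∈ phaseSpace a b) : ∃ ζ : ℝ → State, IsMotion a b ζ ∧ ζ 0 = q := by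
  obtain ⟨h1, h2, h3⟩ := hq
  have hα₁ := (abs_le_of_sum_sq_eq ha h1).1
  have hβ₂ := (abs_le_of_sum_sq_eq hb h2).2.1
  have hE0 : 0 ≤ q.H + a + b := by
    have := neg_abs_le q.α₁
    have := neg_abs_le q.β₂
    have := le_abs_self q.α₁
    have := le_abs_self q.β₂
    unfold State.H
    nlinarith [sq_nonneg q.ω₁, sq_nonneg q.ω₂, sq_nonneg q.ω₃]
  obtain ⟨R, hR⟩ : ∃ R : ℝ, R = 2 * (q.H + a + b) + a + b + 1 := ⟨_, rfl⟩
  have hR1 : 1 ≤ R := by linarith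
  let χ : ContDiffBump (0 : Fin 9 → ℝ) := ⟨R, R + 1, by linarith, by linarith⟩
  have hsmooth : ContDiff ℝ 1 fun v => χ v • eulerPoisson v :=
    χ.contDiff.smul contDiff_eulerPoisson
  have hsupp : HasCompactSupport fun v => χ v • eulerPoisson v := χ.hasCompactSupport.smul_right
  obtain ⟨K, hK⟩ := hsmooth.lipschitzWith_of_hasCompactSupport hsupp one_ne_zero
  obtain ⟨L, hL⟩ := hsupp.exists_bound_of_continuous hsmooth.continuous
  obtain ⟨γ, hγ0, hγ⟩ := exists_global_solution hK hL
    ![q.ω₁, q.ω₂, q.ω₃, q.α₁, q.α₂, q.α₃, q.β₁, q.β₂, q.β₃]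
  have hd : ∀ i t, HasDerivAt (fun u => γ u i) (χ (γ t) * eulerPoisson (γ t) i) t :=
    fun i t => hasDerivAt_pi.1 (hγ t) i
  have c1 : ∀ t, γ t 3 ^ 2 + γ t 4 ^ 2 + γ t 5 ^ 2 = a ^ 2 := by
    intro t
    rw [eq_of_hasDerivAt_zero (f := fun t => γ t 3 ^ 2 + γ t 4 ^ 2 + γ t 5 ^ 2) ?_ t 0]
    · simpa [hγ0] using h1
    · intro t
      refine HasDerivAt.congr_deriv ((((hd 3 t).pow 2).add ((hd 4 t).pow 2)).add
        ((hd 5 t).pow 2)) ?_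
      simp [eulerPoisson]
      ring
  have c2 : ∀ t, γ t 6 ^ 2 + γ t 7 ^ 2 + γ t 8 ^ 2 = b ^ 2 := by
    intro t
    rw [eq_of_hasDerivAt_zero (f := fun t => γ t 6 ^ 2 + γ t 7 ^ 2 + γ t 8 ^ 2) ?_ t 0]
    · simpa [hγ0] using h2
    · intro t
      refine HasDerivAt.congr_deriv ((((hd 6 t).pow 2).add ((hd 7 t).pow 2)).add
        ((hd 8 t).pow 2)) ?_
      simp [eulerPoisson]
      ring
  have c3 : ∀ t, γ t 3 * γ t 6 + γ t 4 * γ t 7 + γ t 5 * γ t 8 = 0 := by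
    intro t
    rw [eq_of_hasDerivAt_zero
      (f := fun t => γ t 3 * γ t 6 + γ t 4 * γ t 7 + γ t 5 * γ t 8) ?_ t 0]
    · simpa [hγ0] using h3
    · intro t
      refine HasDerivAt.congr_deriv ((((hd 3 t).mul (hd 6 t)).add ((hd 4 t).mul (hd 7 t))).add
        ((hd 5 t).mul (hd 8 t))) ?_
      simp [eulerPoisson]
      ring
  have c4 : ∀ t, γ t 0 ^ 2 + γ t 1 ^ 2 + 1 / 2 * γ t 2 ^ 2 - (γ t 3 + γ t 7) = q.H := by
    intro t
    rw [eq_of_hasDerivAt_zero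
      (f := fun t => γ t 0 ^ 2 + γ t 1 ^ 2 + 1 / 2 * γ t 2 ^ 2 - (γ t 3 + γ t 7)) ?_ t 0]
    · simp [hγ0, State.H]
    · intro t
      refine HasDerivAt.congr_deriv (((((hd 0 t).pow 2).add ((hd 1 t).pow 2)).add
        (((hd 2 t).pow 2).const_mul (1 / 2))).sub ((hd 3 t).add (hd 7 t))) ?_
      simp [eulerPoisson]
      ring
  have hbound : ∀ t, χ (γ t) = 1 := by
    intro t
    refine χ.one_of_mem_closedBall ?_
    rw [mem_closedBall_zero_iff]
    refine (pi_norm_le_iff_of_nonneg (by linarith)).2 fun i => ?_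
    have e4 := c4 t
    obtain ⟨b3, b4, b5⟩ := abs_le_of_sum_sq_eq ha (c1 t)
    obtain ⟨b6, b7, b8⟩ := abs_le_of_sum_sq_eq hb (c2 t)
    have hE : γ t 0 ^ 2 + γ t 1 ^ 2 + 1 / 2 * γ t 2 ^ 2 ≤ q.H + a + b := by
      linarith [le_abs_self (γ t 3), le_abs_self (γ t 7)]
    have hω : ∀ x : ℝ, 1 / 2 * x ^ 2 ≤ q.H + a + b → |x| ≤ R := by
      intro x hx
      rw [abs_le]
      constructor <;> nlinarith [sq_nonneg (x - 1), sq_nonneg (x + 1)]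
    have b0 := hω (γ t 0) (by linarith [sq_nonneg (γ t 0), sq_nonneg (γ t 1), sq_nonneg (γ t 2)])
    have b1 := hω (γ t 1) (by linarith [sq_nonneg (γ t 0), sq_nonneg (γ t 1), sq_nonneg (γ t 2)])
    have b2 := hω (γ t 2) (by linarith [sq_nonneg (γ t 0), sq_nonneg (γ t 1), sq_nonneg (γ t 2)])
    rw [Real.norm_eq_abs]
    have haR : a ≤ R := by linarith
    have hbR : b ≤ R := by linarith
    match i with
    | 0 => exact b0
    | 1 => exact b1
    | 2 => exact b2
    | 3 => exact b3.trans haR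
    | 4 => exact b4.trans haR
    | 5 => exact b5.trans haR
    | 6 => exact b6.trans hbR
    | 7 => exact b7.trans hbR
    | 8 => exact b8.trans hbR
  have hd' : ∀ i t, HasDerivAt (fun u => γ u i) (eulerPoisson (γ t) i) t := by
    intro i t
    simpa [hbound t] using hd i t
  refine ⟨fun t => State.ofVec (γ t), ⟨⟨hd' 0, hd' 1, hd' 2, hd' 3, hd' 4, hd' 5, hd' 6, hd' 7,
    hd' 8⟩, fun t => ⟨c1 t, c2 t, c3 t⟩⟩, ?_⟩
  simp [State.ofVec, hγ0]

section Flow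

variable {ζ : ℝ → State}

theorem IsSolution.H_eq (hζ : IsSolution ζ) (t u : ℝ) : (ζ t).H = (ζ u).H := by
  refine eq_of_hasDerivAt_zero (f := fun t => (ζ t).H) (fun t => ?_) t u
  refine HasDerivAt.congr_deriv (((((hζ.hω₁ t).pow 2).add ((hζ.hω₂ t).pow 2)).add
    (((hζ.hω₃ t).pow 2).const_mul (1 / 2))).sub ((hζ.hα₁ t).add (hζ.hβ₂ t))) ?_
  ring

theorem IsSolution.continuous_coords (hζ : IsSolution ζ) :
    Continuous (fun t => (ζ t).ω₁) ∧ Continuous (fun t => (ζ t).ω₂) ∧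
      Continuous (fun t => (ζ t).ω₃) ∧ Continuous (fun t => (ζ t).α₁) ∧
      Continuous (fun t => (ζ t).α₂) ∧ Continuous (fun t => (ζ t).α₃) ∧
      Continuous (fun t => (ζ t).β₁) ∧ Continuous (fun t => (ζ t).β₂) ∧
      Continuous (fun t => (ζ t).β₃) :=
  have h : ∀ {f f' : ℝ → ℝ}, (∀ t, HasDerivAt f (f' t) t) → Continuous f := fun h =>
    continuous_iff_continuousAt.2 fun t => (h t).continuousAt
  ⟨h hζ.hω₁, h hζ.hω₂, h hζ.hω₃, h hζ.hα₁, h hζ.hα₂, h hζ.hα₃, h hζ.hβ₁, h hζ.hβ₂, h hζ.hβ₃⟩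

/-- Along a solution `(ω₁, ω₂, α₃, β₃)` satisfies a homogeneous linear system, so the pendulum
points are invariant under the flow. -/
theorem IsSolution.pendulum_invariant (hζ : IsSolution ζ) (h1 : (ζ 0).ω₁ = 0)
    (h2 : (ζ 0).ω₂ = 0) (h3 : (ζ 0).α₃ = 0) (h4 : (ζ 0).β₃ = 0) (t : ℝ) :
    (ζ t).ω₁ = 0 ∧ (ζ t).ω₂ = 0 ∧ (ζ t).α₃ = 0 ∧ (ζ t).β₃ = 0 := by
  obtain ⟨k1, k2, k3, k4, k5, k6, k7, k8, k9⟩ := hζ.continuous_coords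
  have key := linear_system_eq_zero
    (A := fun t => !![0, (ζ t).ω₃ / 2, 0, 1 / 2; -(ζ t).ω₃ / 2, 0, -1 / 2, 0;
      -(ζ t).α₂, (ζ t).α₁, 0, 0; -(ζ t).β₂, (ζ t).β₁, 0, 0])
    (e := fun t => ![(ζ t).ω₁, (ζ t).ω₂, (ζ t).α₃, (ζ t).β₃]) (t₀ := 0) ?_ ?_
    (by simp [h1, h2, h3, h4]) t
  · exact ⟨congrFun key 0, congrFun key 1, congrFun key 2, congrFun key 3⟩
  · intro i j
    fin_cases i <;> fin_cases j <;> simp <;> fun_prop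
  · intro i t
    match i with
    | 0 =>
      refine HasDerivAt.congr_deriv (hζ.hω₁ t) ?_
      simp [Matrix.mulVec, dotProduct, Fin.sum_univ_succ]
      try ring
    | 1 =>
      refine HasDerivAt.congr_deriv (hζ.hω₂ t) ?_
      simp [Matrix.mulVec, dotProduct, Fin.sum_univ_succ]
      try ring
    | 2 =>
      refine HasDerivAt.congr_deriv (hζ.hα₃ t) ?_
      simp [Matrix.mulVec, dotProduct, Fin.sum_univ_succ]
      try ring
    | 3 =>
      refine HasDerivAt.congr_deriv (hζ.hβ₃ t) ?_
      simp [Matrix.mulVec, dotProduct, Fin.sum_univ_succ]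
      try ring

end Flow

/-- The vector of the five polynomials whose common zeros form the set `𝔒` with the constants
`(s, τ)`. With `γ = α × β` the first four are the coordinates of `M·α + s M₁`, `M·β + s M₂`,
`γ₁ - s (ω₁ω₃ + α₃)`, `γ₂ - s (ω₂ω₃ + β₃)`; the last one is
`2 s (ω₁² + ω₂²) - |x₁|² - |z₁|² + τ`. Unlike `R₁`, `R₂`, `S` they have no denominators and make
sense where `w₁ = 0`. -/
noncomputable def State.defect (s τ : ℝ) (q : State) : Fin 5 → ℝ :=
  ![q.Mα + 2 * s * q.ω₁, q.Mβ + 2 * s * q.ω₂,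
    q.α₂ * q.β₃ - q.α₃ * q.β₂ - s * (q.ω₁ * q.ω₃ + q.α₃),
    q.α₃ * q.β₁ - q.α₁ * q.β₃ - s * (q.ω₂ * q.ω₃ + q.β₃),
    2 * s * (q.ω₁ ^ 2 + q.ω₂ ^ 2) - ((q.α₁ - q.β₂) ^ 2 + (q.α₂ + q.β₁) ^ 2) -
      (q.α₃ ^ 2 + q.β₃ ^ 2) + τ]

/-- On the energy level `2 s (H - s) = a² + b² - τ` the derivative of `State.defect` along a motion
is linear homogeneous in `State.defect`, so its zero set is invariant, also across the instants
where `w₁ = 0`. -/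
theorem IsMotion.defect_invariant {a b s τ : ℝ} {ζ : ℝ → State} (hζ : IsMotion a b ζ)
    (hH : 2 * s * ((ζ 0).H - s) = a ^ 2 + b ^ 2 - τ) (h0 : (ζ 0).defect s τ = 0) (t : ℝ) :
    (ζ t).defect s τ = 0 := by
  obtain ⟨hs, hP⟩ := hζ
  obtain ⟨k1, k2, k3, k4, k5, k6, k7, k8, k9⟩ := hs.continuous_coords
  refine linear_system_eq_zero
    (A := fun t => !![0, 0, 0, -1, 0; 0, 0, 1, 0, 0;
      0, s / 2, 0, (ζ t).ω₃, -(ζ t).ω₂ / 2; -s / 2, 0, -(ζ t).ω₃, 0, (ζ t).ω₁ / 2;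
      (ζ t).β₃, -(ζ t).α₃, 0, 0, 0])
    (e := fun t => (ζ t).defect s τ) ?_ ?_ h0 t
  · intro i j
    fin_cases i <;> fin_cases j <;> simp <;> fun_prop
  · intro i t
    obtain ⟨p1, p2, p3⟩ := hP t
    have hHt : 2 * s * ((ζ t).H - s) = a ^ 2 + b ^ 2 - τ := by rw [hs.H_eq t 0, hH]
    unfold State.H at hHt
    have d1 := hs.hω₁ t
    have d2 := hs.hω₂ t
    have d3 := hs.hω₃ t
    have d4 := hs.hα₁ t
    have d5 := hs.hα₂ t
    have d6 := hs.hα₃ t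
    have d7 := hs.hβ₁ t
    have d8 := hs.hβ₂ t
    have d9 := hs.hβ₃ t
    match i with
    | 0 =>
      refine HasDerivAt.congr_deriv ((((((d1.const_mul 2).mul d4).add ((d2.const_mul 2).mul d5)).add
        (d3.mul d6)).add (d1.const_mul (2 * s)))) ?_
      simp [Matrix.mulVec, dotProduct, Fin.sum_univ_succ, State.defect]
      ring
    | 1 =>
      refine HasDerivAt.congr_deriv ((((((d1.const_mul 2).mul d7).add ((d2.const_mul 2).mul d8)).add
        (d3.mul d9)).add (d2.const_mul (2 * s)))) ?_
      simp [Matrix.mulVec, dotProduct, Fin.sum_univ_succ, State.defect]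
      ring
    | 2 =>
      refine HasDerivAt.congr_deriv (((d5.mul d9).sub (d6.mul d8)).sub
        (((d1.mul d3).add d6).const_mul s)) ?_
      simp [Matrix.mulVec, dotProduct, Fin.sum_univ_succ, State.defect, State.Mα, State.Mβ]
      linear_combination (ζ t).ω₂ / 2 * hHt - (ζ t).ω₂ / 2 * (p1 + p2)
    | 3 =>
      refine HasDerivAt.congr_deriv (((d6.mul d7).sub (d4.mul d9)).sub
        (((d2.mul d3).add d9).const_mul s)) ?_
      simp [Matrix.mulVec, dotProduct, Fin.sum_univ_succ, State.defect, State.Mα, State.Mβ]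
      linear_combination (ζ t).ω₁ / 2 * (p1 + p2) - (ζ t).ω₁ / 2 * hHt
    | 4 =>
      refine HasDerivAt.congr_deriv (((((d1.pow 2).add (d2.pow 2)).const_mul (2 * s)).sub
        (((d4.sub d8).pow 2).add ((d5.add d7).pow 2))).sub
        ((d6.pow 2).add (d9.pow 2)) |>.add_const τ) ?_
      simp [Matrix.mulVec, dotProduct, Fin.sum_univ_succ, State.defect, State.Mα, State.Mβ]
      ring

/-! ### Polynomial equations of the invariant set -/

namespace State

theorem defect_eq_zero_iff (s τ : ℝ) (q : State) : q.defect s τ = 0 ↔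
    q.Mα + 2 * s * q.ω₁ = 0 ∧ q.Mβ + 2 * s * q.ω₂ = 0 ∧
    q.α₂ * q.β₃ - q.α₃ * q.β₂ - s * (q.ω₁ * q.ω₃ + q.α₃) = 0 ∧
    q.α₃ * q.β₁ - q.α₁ * q.β₃ - s * (q.ω₂ * q.ω₃ + q.β₃) = 0 ∧
    2 * s * (q.ω₁ ^ 2 + q.ω₂ ^ 2) - ((q.α₁ - q.β₂) ^ 2 + (q.α₂ + q.β₁) ^ 2) -
      (q.α₃ ^ 2 + q.β₃ ^ 2) + τ = 0 := by
  refine ⟨fun h => ⟨congrFun h 0, congrFun h 1, congrFun h 2, congrFun h 3, congrFun h 4⟩,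
    fun ⟨h0, h1, h2, h3, h4⟩ => funext fun i => ?_⟩
  match i with
  | 0 => exact h0
  | 1 => exact h1
  | 2 => exact h2
  | 3 => exact h3
  | 4 => exact h4

theorem w₁_eq_zero_iff (q : State) : q.w₁ = 0 ↔ q.ω₁ = 0 ∧ q.ω₂ = 0 := by
  simp [w₁, Complex.ext_iff]

theorem z₁_eq_zero_iff (q : State) : q.z₁ = 0 ↔ q.α₃ = 0 ∧ q.β₃ = 0 := by
  simp [z₁, Complex.ext_iff]

theorem w₁_ne_zero_iff (q : State) : q.w₁ ≠ 0 ↔ 0 < q.ω₁ ^ 2 + q.ω₂ ^ 2 := by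
  rw [Ne, w₁_eq_zero_iff]
  constructor
  · intro h
    rcases (add_nonneg (sq_nonneg q.ω₁) (sq_nonneg q.ω₂)).lt_or_eq with h' | h'
    · exact h'
    · exact absurd ⟨by nlinarith [sq_nonneg q.ω₁, sq_nonneg q.ω₂],
        by nlinarith [sq_nonneg q.ω₁, sq_nonneg q.ω₂]⟩ h
  · rintro h ⟨h1, h2⟩
    simp [h1, h2] at h

theorem w₂_ne_zero {q : State} (h : q.w₁ ≠ 0) : q.w₂ ≠ 0 := by
  intro h2
  refine h ((w₁_eq_zero_iff q).2 ?_)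
  simpa [w₂, Complex.ext_iff] using h2

/-- `R₁ = 0` says that `(Mα, Mβ)` is parallel to `(ω₁, ω₂)`. -/
theorem R₁_eq_zero_iff {q : State} (h : q.w₁ ≠ 0) :
    q.R₁ = 0 ↔ q.Mβ * q.ω₁ - q.Mα * q.ω₂ = 0 := by
  have h2 := w₂_ne_zero h
  rw [R₁, div_sub_div _ _ h h2, div_eq_zero_iff, or_iff_left (mul_ne_zero h h2)]
  have : (q.w₂ * q.x₁ + q.w₁ * q.y₂ + q.w₃ * q.z₁) * q.w₂ -
      q.w₁ * (q.w₁ * q.x₂ + q.w₂ * q.y₁ + q.w₃ * q.z₂) =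
      ((2 * (q.Mβ * q.ω₁ - q.Mα * q.ω₂) : ℝ) : ℂ) * Complex.I := by
    apply Complex.ext <;> simp [x₁, x₂, y₁, y₂, z₁, z₂, w₁, w₂, w₃, Mα, Mβ] <;> ring
  rw [this, mul_eq_zero, or_iff_left Complex.I_ne_zero, Complex.ofReal_eq_zero]
  constructor <;> intro h <;> linarith

/-- Once `M·α = -s M₁` and `M·β = -s M₂`, the function `R₂` is a real polynomial. -/
theorem R₂_eq {q : State} (h : q.w₁ ≠ 0) {s : ℝ} (hα : q.Mα + 2 * s * q.ω₁ = 0)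
    (hβ : q.Mβ + 2 * s * q.ω₂ = 0) :
    q.R₂ = ((4 * ((q.α₁ - q.β₂) * (q.ω₁ * q.α₃ - q.ω₂ * q.β₃) +
      (q.α₂ + q.β₁) * (q.ω₁ * q.β₃ + q.ω₂ * q.α₃)) +
      2 * (q.α₃ ^ 2 + q.β₃ ^ 2 - 2 * s * (q.ω₁ ^ 2 + q.ω₂ ^ 2)) * q.ω₃ : ℝ) : ℂ) := by
  have h2 := w₂_ne_zero h
  have hE : q.w₂ * q.x₁ + q.w₁ * q.y₂ + q.w₃ * q.z₁ + 2 * s * q.w₁ = 0 := by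
    have : q.w₂ * q.x₁ + q.w₁ * q.y₂ + q.w₃ * q.z₁ + 2 * s * q.w₁ =
        ((q.Mα + 2 * s * q.ω₁ : ℝ) : ℂ) + Complex.I * ((q.Mβ + 2 * s * q.ω₂ : ℝ) : ℂ) := by
      apply Complex.ext <;> simp [x₁, y₂, z₁, w₁, w₂, w₃, Mα, Mβ] <;> ring
    rw [this, hα, hβ]; simp
  have hE' : q.w₁ * q.x₂ + q.w₂ * q.y₁ + q.w₃ * q.z₂ + 2 * s * q.w₂ = 0 := by
    have : q.w₁ * q.x₂ + q.w₂ * q.y₁ + q.w₃ * q.z₂ + 2 * s * q.w₂ =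
        ((q.Mα + 2 * s * q.ω₁ : ℝ) : ℂ) - Complex.I * ((q.Mβ + 2 * s * q.ω₂ : ℝ) : ℂ) := by
      apply Complex.ext <;> simp [x₂, y₁, z₂, w₁, w₂, w₃, Mα, Mβ] <;> ring
    rw [this, hα, hβ]; simp
  have hR : q.R₂ = 2 * (q.x₁ * q.w₂ * q.z₂ + q.x₂ * q.w₁ * q.z₁ +
      (q.z₁ * q.z₂ - 2 * s * q.w₁ * q.w₂) * q.w₃) := by
    unfold R₂
    simp only [div_eq_mul_inv]
    linear_combination (q.w₂ * q.z₁ * q.w₁⁻¹ + q.w₂ * q.w₃ - q.z₂) * hE +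
      (q.w₁ * q.z₂ * q.w₂⁻¹ + q.w₁ * q.w₃ - q.z₁) * hE' -
      q.w₂ * q.z₁ * (q.y₂ + 2 * s) * mul_inv_cancel₀ h -
      q.w₁ * q.z₂ * (q.y₁ + 2 * s) * mul_inv_cancel₀ h2
  rw [hR]
  apply Complex.ext <;> simp [x₁, x₂, z₁, z₂, w₁, w₂, w₃, pow_two] <;> ring

end State

open State

variable {a b s τ x σ : ℝ} {q : State}

/-- On `P⁶` the quantity `|x₁|² + |z₁|²` is `a² + b²` minus twice the third coordinate of
`α × β`. -/
theorem normSq_add_normSq (hq : q ∈ phaseSpace a b) :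
    ((q.α₁ - q.β₂) ^ 2 + (q.α₂ + q.β₁) ^ 2) + (q.α₃ ^ 2 + q.β₃ ^ 2) =
      a ^ 2 + b ^ 2 - 2 * (q.α₁ * q.β₂ - q.α₂ * q.β₁) := by
  obtain ⟨h1, h2, -⟩ := hq
  linear_combination h1 + h2

/-- Where `w₁ ≠ 0`, the rational equations `R₁ = R₂ = 0`, `S = s`, `T = τ` are equivalent to the
polynomial ones. -/
theorem regular_iff_defect (hq : q ∈ phaseSpace a b) (hw : q.w₁ ≠ 0) :
    (q ∈ regularPart a b ∧ J a b q = (s, τ)) ↔ q.defect s τ = 0 := by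
  have hW := (w₁_ne_zero_iff q).1 hw
  have hσ := normSq_add_normSq hq
  have hS : q.S = -(q.Mα * q.ω₁ + q.Mβ * q.ω₂) / (2 * (q.ω₁ ^ 2 + q.ω₂ ^ 2)) := by
    unfold State.S M₁ M₂
    have : (2 * q.ω₁) ^ 2 + (2 * q.ω₂) ^ 2 ≠ 0 := by nlinarith
    field_simp
  rw [defect_eq_zero_iff]
  constructor
  · rintro ⟨⟨-, -, hR1, hR2⟩, hJ⟩
    obtain ⟨hs, hτ⟩ := Prod.mk.inj hJ
    rw [R₁_eq_zero_iff hw] at hR1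
    rw [hS, div_eq_iff (by positivity)] at hs
    have e1 : q.Mα + 2 * s * q.ω₁ = 0 := by
      refine (mul_eq_zero.1 ?_).resolve_left hW.ne'
      linear_combination -q.ω₂ * hR1 - q.ω₁ * hs
    have e2 : q.Mβ + 2 * s * q.ω₂ = 0 := by
      refine (mul_eq_zero.1 ?_).resolve_left hW.ne'
      linear_combination q.ω₁ * hR1 - q.ω₂ * hs
    rw [R₂_eq hw e1 e2, Complex.ofReal_eq_zero] at hR2
    -- the components of `(γ₁ + iγ₂) - s (w₁w₃ + z₁)` along `w₁` and `i w₁`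
    have k1 : q.ω₁ * (q.α₂ * q.β₃ - q.α₃ * q.β₂ - s * (q.ω₁ * q.ω₃ + q.α₃)) +
        q.ω₂ * (q.α₃ * q.β₁ - q.α₁ * q.β₃ - s * (q.ω₂ * q.ω₃ + q.β₃)) = 0 := by
      unfold Mα at e1
      unfold Mβ at e2
      linear_combination (1 / 4) * hR2 - (1 / 2) * (q.α₃ * e1 + q.β₃ * e2)
    have k2 : q.ω₁ * (q.α₃ * q.β₁ - q.α₁ * q.β₃ - s * (q.ω₂ * q.ω₃ + q.β₃)) -
        q.ω₂ * (q.α₂ * q.β₃ - q.α₃ * q.β₂ - s * (q.ω₁ * q.ω₃ + q.α₃)) = 0 := by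
      unfold Mα at e1
      unfold Mβ at e2
      linear_combination (1 / 2) * (q.α₃ * e2 - q.β₃ * e1)
    refine ⟨e1, e2, (mul_eq_zero.1 ?_).resolve_left hW.ne', (mul_eq_zero.1 ?_).resolve_left hW.ne',
      ?_⟩
    · linear_combination q.ω₁ * k1 - q.ω₂ * k2
    · linear_combination q.ω₂ * k1 + q.ω₁ * k2
    · simp only [State.T, M₁, M₂] at hτ
      linear_combination q.ω₁ * e1 + q.ω₂ * e2 - hτ - hσ
  · rintro ⟨e1, e2, n1, n2, e4⟩
    refine ⟨⟨hq, hw, ?_, ?_⟩, ?_⟩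
    · rw [R₁_eq_zero_iff hw]
      linear_combination q.ω₁ * e2 - q.ω₂ * e1
    · rw [R₂_eq hw e1 e2, Complex.ofReal_eq_zero]
      unfold Mα at e1
      unfold Mβ at e2
      linear_combination 4 * q.ω₁ * n1 + 4 * q.ω₂ * n2 + 2 * (q.α₃ * e1 + q.β₃ * e2)
    · refine Prod.ext ?_ ?_
      · change q.S = s
        rw [hS, div_eq_iff (by positivity)]
        linear_combination -q.ω₁ * e1 - q.ω₂ * e2
      · change q.T a b = τ
        simp only [State.T, M₁, M₂]
        linear_combination -e4 + q.ω₁ * e1 + q.ω₂ * e2 - hσ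

/-- The third coordinate of `α × β` from the third coordinates of `α` and `β`. -/
theorem cross_third_sq (hq : q ∈ phaseSpace a b) :
    (q.α₁ * q.β₂ - q.α₂ * q.β₁) ^ 2 =
      a ^ 2 * b ^ 2 - b ^ 2 * q.α₃ ^ 2 - a ^ 2 * q.β₃ ^ 2 := by
  obtain ⟨h1, h2, h3⟩ := hq
  rw [← h1, ← h2]
  linear_combination (q.α₃ * q.β₃ - q.α₁ * q.β₁ - q.α₂ * q.β₂) * h3

/-- The set `𝔒` has no points with `w₁ ≠ 0` and `s = 0`: there `M` would be orthogonal to the plane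
of `α` and `β`, which is then the plane of `e₁` and `e₂`. -/
theorem s_ne_zero_of_defect (ha : 0 < a) (hb : 0 < b) (hq : q ∈ phaseSpace a b)
    (hw : q.w₁ ≠ 0) (h : q.defect s τ = 0) : s ≠ 0 := by
  rintro rfl
  obtain ⟨e1, e2, n1, n2, -⟩ := (defect_eq_zero_iff _ _ _).1 h
  have hγ := cross_third_sq hq
  obtain ⟨h1, h2, h3⟩ := hq
  have hγ0 : q.α₁ * q.β₂ - q.α₂ * q.β₁ ≠ 0 := by
    intro h0
    have hsum : (q.α₂ * q.β₃ - q.α₃ * q.β₂) ^ 2 + (q.α₃ * q.β₁ - q.α₁ * q.β₃) ^ 2 +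
        (q.α₁ * q.β₂ - q.α₂ * q.β₁) ^ 2 = a ^ 2 * b ^ 2 := by
      rw [← h1, ← h2]
      linear_combination
        -(q.α₁ * q.β₁ + q.α₂ * q.β₂ + q.α₃ * q.β₃) * h3
    have n1' : q.α₂ * q.β₃ - q.α₃ * q.β₂ = 0 := by linear_combination n1
    have n2' : q.α₃ * q.β₁ - q.α₁ * q.β₃ = 0 := by linear_combination n2
    rw [n1', n2', h0] at hsum
    nlinarith [mul_pos (pow_pos ha 2) (pow_pos hb 2)]
  have hα₃ : q.α₃ = 0 := by
    refine (mul_eq_zero.1 ?_).resolve_left hγ0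
    linear_combination -q.α₁ * n1 - q.α₂ * n2
  have hβ₃ : q.β₃ = 0 := by
    refine (mul_eq_zero.1 ?_).resolve_left hγ0
    linear_combination -q.β₁ * n1 - q.β₂ * n2
  unfold Mα at e1
  unfold Mβ at e2
  rw [hα₃] at e1
  rw [hβ₃] at e2
  refine hw ((w₁_eq_zero_iff q).2 ⟨?_, ?_⟩)
  · refine (mul_eq_zero.1 ?_).resolve_left hγ0
    linear_combination (q.β₂ / 2) * e1 - (q.α₂ / 2) * e2
  · refine (mul_eq_zero.1 ?_).resolve_left hγ0
    linear_combination (q.α₁ / 2) * e2 - (q.β₁ / 2) * e1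

/-- The Kowalevski integral on `𝔒`, in complex variables; `x₁, x₂` and so on need not be
conjugate. -/
theorem kowalevski_identity {x₁ x₂ y₁ y₂ z₁ z₂ w₁ w₂ w₃ s τ p r : ℂ} (hw₁ : w₁ ≠ 0)
    (hw₂ : w₂ ≠ 0) (h1 : x₁ * y₂ + z₁ ^ 2 = r) (h1' : x₂ * y₁ + z₂ ^ 2 = r)
    (h2 : x₁ * x₂ + y₁ * y₂ + 2 * (z₁ * z₂) = 2 * p)
    (hE : w₂ * x₁ + w₁ * y₂ + w₃ * z₁ + 2 * s * w₁ = 0)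
    (hE' : w₁ * x₂ + w₂ * y₁ + w₃ * z₂ + 2 * s * w₂ = 0)
    (h4 : 2 * s * (w₁ * w₂) = x₁ * x₂ + z₁ * z₂ - τ)
    (hR : x₁ * w₂ * z₂ + x₂ * w₁ * z₁ = (x₁ * x₂ - τ) * w₃) :
    4 * s ^ 2 * ((w₁ ^ 2 + x₁) * (w₂ ^ 2 + x₂)) =
      τ ^ 2 - 2 * p * τ + r ^ 2 + 4 * s ^ 2 * τ := by
  have hB : 2 * s * w₂ ^ 2 * x₁ + (2 * s * (x₁ * x₂ - τ) - τ * y₂ + r * x₂) = 0 := by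
    refine (mul_eq_zero.1 ?_).resolve_left hw₁
    linear_combination w₂ * x₁ * h4 + (x₁ * x₂ - τ) * hE + z₁ * hR - w₁ * x₂ * h1
  have hB' : 2 * s * w₁ ^ 2 * x₂ + (2 * s * (x₁ * x₂ - τ) - τ * y₁ + r * x₁) = 0 := by
    refine (mul_eq_zero.1 ?_).resolve_left hw₂
    linear_combination w₁ * x₂ * h4 + (x₁ * x₂ - τ) * hE' + z₂ * hR - w₂ * x₁ * h1'
  have hκ : (x₁ * x₂ + z₁ * z₂ - τ) ^ 2 - (τ ^ 2 - 2 * p * τ + r ^ 2) =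
      (x₁ * x₂ - τ) * (x₁ * x₂ - y₁ * y₂) + 2 * (x₁ * x₂) * (z₁ * z₂) -
      (x₁ * y₂ * z₂ ^ 2 + x₂ * y₁ * z₁ ^ 2) := by
    linear_combination -τ * h2 + r * h1 + (x₁ * y₂ + z₁ ^ 2) * h1'
  have hI : (x₁ * x₂ - τ) * (x₁ * x₂ - (y₂ + 2 * s) * (y₁ + 2 * s)) +
      2 * (x₁ * x₂) * (z₁ * z₂) -
      (x₁ * z₂ ^ 2 * (y₂ + 2 * s) + x₂ * z₁ ^ 2 * (y₁ + 2 * s)) = 0 := by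
    refine (mul_eq_zero.1 ?_).resolve_left (mul_ne_zero hw₁ hw₂)
    have ha : w₁ * (y₂ + 2 * s) = -(w₂ * x₁ + w₃ * z₁) := by linear_combination hE
    have hb : w₂ * (y₁ + 2 * s) = -(w₁ * x₂ + w₃ * z₂) := by linear_combination hE'
    have hc : w₁ * w₂ * ((y₂ + 2 * s) * (y₁ + 2 * s)) =
        (w₂ * x₁ + w₃ * z₁) * (w₁ * x₂ + w₃ * z₂) := by
      linear_combination w₂ * (y₁ + 2 * s) * ha - (w₂ * x₁ + w₃ * z₁) * hb
    linear_combination -(x₁ * x₂ - τ) * hc - w₂ * x₁ * z₂ ^ 2 * ha - w₁ * x₂ * z₁ ^ 2 * hb +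
      (x₁ * w₂ * z₂ + x₂ * w₁ * z₁ + w₃ * (z₁ * z₂)) * hR
  linear_combination 2 * s * (hB + hB') + hκ + hI +
    (2 * s * (w₁ * w₂) + (x₁ * x₂ + z₁ * z₂ - τ)) * h4 + 2 * s * (x₂ * h1 + x₁ * h1')

/-- The energy on `𝔒`, in complex variables. -/
theorem energy_identity {x₁ x₂ y₁ y₂ z₁ z₂ w₁ w₂ w₃ s τ p : ℂ} (hw₁ : w₁ ≠ 0)
    (hw₂ : w₂ ≠ 0) (h2 : x₁ * x₂ + y₁ * y₂ + 2 * (z₁ * z₂) = 2 * p)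
    (hE : w₂ * x₁ + w₁ * y₂ + w₃ * z₁ + 2 * s * w₁ = 0)
    (hE' : w₁ * x₂ + w₂ * y₁ + w₃ * z₂ + 2 * s * w₂ = 0)
    (h4 : 2 * s * (w₁ * w₂) = x₁ * x₂ + z₁ * z₂ - τ)
    (hR : x₁ * w₂ * z₂ + x₂ * w₁ * z₁ = (x₁ * x₂ - τ) * w₃) :
    2 * s * (2 * (w₁ * w₂) + w₃ ^ 2 - (y₁ + y₂) - 2 * s) = 2 * (p - τ) := by
  have ha : w₁ * (y₂ + 2 * s) = -(w₂ * x₁ + w₃ * z₁) := by linear_combination hE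
  have hb : w₂ * (y₁ + 2 * s) = -(w₁ * x₂ + w₃ * z₂) := by linear_combination hE'
  have hc : (y₂ + 2 * s) * (y₁ + 2 * s) - x₁ * x₂ - 2 * s * w₃ ^ 2 = 0 := by
    refine (mul_eq_zero.1 ?_).resolve_left (mul_ne_zero hw₁ hw₂)
    linear_combination w₂ * (y₁ + 2 * s) * ha - (w₂ * x₁ + w₃ * z₁) * hb + w₃ * hR - w₃ ^ 2 * h4
  linear_combination 2 * h4 + h2 - hc

/-- The values of `H` and `K` on `𝔒`. -/
theorem integrals_of_defect (hq : q ∈ phaseSpace a b) (hw : q.w₁ ≠ 0) (h : q.defect s τ = 0) :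
    2 * s * (q.H - s) = a ^ 2 + b ^ 2 - τ ∧
    4 * s ^ 2 * q.K =
      τ ^ 2 - 2 * (a ^ 2 + b ^ 2) * τ + (a ^ 2 - b ^ 2) ^ 2 + 4 * s ^ 2 * τ := by
  obtain ⟨e1, e2, n1, n2, e4⟩ := (defect_eq_zero_iff _ _ _).1 h
  have hw2 := w₂_ne_zero hw
  obtain ⟨p1, p2, p3⟩ := hq
  have h1 : q.x₁ * q.y₂ + q.z₁ ^ 2 = ((a ^ 2 - b ^ 2 : ℝ) : ℂ) := by
    apply Complex.ext <;> simp [x₁, y₂, z₁, pow_two]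
    · linear_combination p1 - p2
    · linear_combination 2 * p3
  have h1' : q.x₂ * q.y₁ + q.z₂ ^ 2 = ((a ^ 2 - b ^ 2 : ℝ) : ℂ) := by
    apply Complex.ext <;> simp [x₂, y₁, z₂, pow_two]
    · linear_combination p1 - p2
    · linear_combination -2 * p3
  have h2 : q.x₁ * q.x₂ + q.y₁ * q.y₂ + 2 * (q.z₁ * q.z₂) =
      2 * ((a ^ 2 + b ^ 2 : ℝ) : ℂ) := by
    apply Complex.ext <;> simp [x₁, x₂, y₁, y₂, z₁, z₂, pow_two]
    · linear_combination 2 * p1 + 2 * p2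
    · ring
  unfold Mα at e1
  unfold Mβ at e2
  have hE : q.w₂ * q.x₁ + q.w₁ * q.y₂ + q.w₃ * q.z₁ + 2 * s * q.w₁ = 0 := by
    apply Complex.ext <;> simp [x₁, y₂, z₁, w₁, w₂, w₃]
    · linear_combination e1
    · linear_combination e2
  have hE' : q.w₁ * q.x₂ + q.w₂ * q.y₁ + q.w₃ * q.z₂ + 2 * s * q.w₂ = 0 := by
    apply Complex.ext <;> simp [x₂, y₁, z₂, w₁, w₂, w₃]
    · linear_combination e1
    · linear_combination -e2
  have h4 : 2 * (s : ℂ) * (q.w₁ * q.w₂) = q.x₁ * q.x₂ + q.z₁ * q.z₂ - τ := by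
    apply Complex.ext <;> simp [x₁, x₂, z₁, z₂, w₁, w₂]
    · linear_combination e4
    · ring
  have hR : q.x₁ * q.w₂ * q.z₂ + q.x₂ * q.w₁ * q.z₁ = (q.x₁ * q.x₂ - τ) * q.w₃ := by
    apply Complex.ext <;> simp [x₁, x₂, z₁, z₂, w₁, w₂, w₃]
    · linear_combination 2 * q.ω₁ * n1 + 2 * q.ω₂ * n2 + q.α₃ * e1 + q.β₃ * e2 + q.ω₃ * e4
    · ring
  constructor
  · have key := energy_identity hw hw2 h2 hE hE' h4 hR
    have := congrArg Complex.re key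
    simp [y₁, y₂, w₁, w₂, w₃, pow_two] at this
    unfold State.H
    linear_combination (1 / 2) * this
  · have key := kowalevski_identity hw hw2 h1 h1' h2 hE hE' h4 hR
    have := congrArg Complex.re key
    simp [x₁, x₂, w₁, w₂, pow_two] at this
    unfold State.K
    linear_combination this

/-! ### The triangle of admissible configurations -/

/-- The triangle in the `(x, σ)`-plane with the vertices `(0, a² - b²)`, `(a - b, (a - b)²)` and
`(a + b, (a + b)²)`. At the points of `P⁶` the pair `x = |x₁|`, `σ = |x₁|² + |z₁|²` lies in it. -/
structure InTriangle (a b x σ : ℝ) : Prop where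
  le_left : σ ≤ a ^ 2 - b ^ 2 + 2 * b * x
  ge_left : a ^ 2 - b ^ 2 - 2 * b * x ≤ σ
  ge_right : 2 * a * x - (a ^ 2 - b ^ 2) ≤ σ

/-- An affine function that is positive at the vertices is positive on the triangle. -/
theorem InTriangle.pos_of_vertices (hb : 0 < b) (hab : b < a) (h : InTriangle a b x σ)
    {u v c : ℝ} (hA : 0 < v * (a ^ 2 - b ^ 2) + c)
    (hB : 0 < u * (a - b) + v * (a - b) ^ 2 + c)
    (hC : 0 < u * (a + b) + v * (a + b) ^ 2 + c) : 0 < u * x + v * σ + c := by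
  obtain ⟨h1, h2, h3⟩ := h
  have e1 := sub_nonneg.2 h1
  have e2 := sub_nonneg.2 h2
  have e3 := sub_nonneg.2 h3
  have hr : 0 < a ^ 2 - b ^ 2 := by nlinarith
  -- barycentric coordinates, up to a common positive factor
  have key : 4 * b * (a ^ 2 - b ^ 2) * (u * x + v * σ + c) =
      2 * b * (σ - (2 * a * x - (a ^ 2 - b ^ 2))) * (v * (a ^ 2 - b ^ 2) + c) +
      (a + b) * (a ^ 2 - b ^ 2 + 2 * b * x - σ) * (u * (a - b) + v * (a - b) ^ 2 + c) +
      (a - b) * (σ - (a ^ 2 - b ^ 2 - 2 * b * x)) * (u * (a + b) + v * (a + b) ^ 2 + c) := by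
    ring
  have hab0 : 0 < a - b := sub_pos.2 hab
  have ha : 0 < a := hb.trans hab
  have t1 := mul_nonneg (mul_nonneg (by positivity : 0 ≤ 2 * b) e3) hA.le
  have t2 := mul_nonneg (mul_nonneg (by positivity : 0 ≤ a + b) e1) hB.le
  have t3 := mul_nonneg (mul_nonneg hab0.le e2) hC.le
  refine pos_of_mul_pos_right (?_ : 0 < 4 * b * (a ^ 2 - b ^ 2) * _) (by positivity)
  rw [key]
  by_contra hneg
  have z1 : 2 * b * (σ - (2 * a * x - (a ^ 2 - b ^ 2))) * (v * (a ^ 2 - b ^ 2) + c) = 0 := by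
    linarith
  have z2 : (a + b) * (a ^ 2 - b ^ 2 + 2 * b * x - σ) *
      (u * (a - b) + v * (a - b) ^ 2 + c) = 0 := by linarith
  have z3 : (a - b) * (σ - (a ^ 2 - b ^ 2 - 2 * b * x)) *
      (u * (a + b) + v * (a + b) ^ 2 + c) = 0 := by linarith
  have y1 := (mul_eq_zero.1 ((mul_eq_zero.1 z1).resolve_right hA.ne')).resolve_left (by positivity)
  have y2 := (mul_eq_zero.1 ((mul_eq_zero.1 z2).resolve_right hB.ne')).resolve_left (by positivity)
  have y3 := (mul_eq_zero.1 ((mul_eq_zero.1 z3).resolve_right hC.ne')).resolve_left hab0.ne'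
  nlinarith

theorem InTriangle.le_sq (hb : 0 < b) (hab : b < a) (h : InTriangle a b x σ) :
    σ ≤ (a + b) ^ 2 := by
  obtain ⟨h1, h2, h3⟩ := h
  have : 0 < a - b := sub_pos.2 hab
  refine le_of_mul_le_mul_left ?_ this
  nlinarith

theorem InTriangle.sq_le (hb : 0 < b) (hab : b < a) (h : InTriangle a b x σ) :
    (a - b) ^ 2 ≤ σ := by
  obtain ⟨h1, h2, h3⟩ := h
  have : 0 < a + b := by linarith
  refine le_of_mul_le_mul_left ?_ this
  nlinarith

/-- `4 s² K` on `𝔒`, as a function of the constants `(s, τ)`. -/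
noncomputable def kowalevskiSq (a b s τ : ℝ) : ℝ :=
  τ ^ 2 - 2 * (a ^ 2 + b ^ 2) * τ + (a ^ 2 - b ^ 2) ^ 2 + 4 * s ^ 2 * τ

theorem kowalevskiSq_factor_inner (hb : s ^ 2 ≤ b ^ 2) (ha : s ^ 2 ≤ a ^ 2) :
    kowalevskiSq a b s τ = (τ - (√(a ^ 2 - s ^ 2) + √(b ^ 2 - s ^ 2)) ^ 2) *
      (τ - (√(a ^ 2 - s ^ 2) - √(b ^ 2 - s ^ 2)) ^ 2) := by
  have hu := Real.sq_sqrt (sub_nonneg.2 ha)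
  have hv := Real.sq_sqrt (sub_nonneg.2 hb)
  generalize √(a ^ 2 - s ^ 2) = u at *
  generalize √(b ^ 2 - s ^ 2) = v at *
  have hu' : a ^ 2 = u ^ 2 + s ^ 2 := by linarith
  have hv' : b ^ 2 = v ^ 2 + s ^ 2 := by linarith
  rw [kowalevskiSq, hu', hv']
  ring

theorem kowalevskiSq_factor_outer (hb : b ^ 2 ≤ s ^ 2) (ha : a ^ 2 ≤ s ^ 2) :
    kowalevskiSq a b s τ = (τ + (√(s ^ 2 - b ^ 2) - √(s ^ 2 - a ^ 2)) ^ 2) *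
      (τ + (√(s ^ 2 - b ^ 2) + √(s ^ 2 - a ^ 2)) ^ 2) := by
  have hu := Real.sq_sqrt (sub_nonneg.2 ha)
  have hv := Real.sq_sqrt (sub_nonneg.2 hb)
  generalize √(s ^ 2 - a ^ 2) = u at *
  generalize √(s ^ 2 - b ^ 2) = v at *
  have hu' : a ^ 2 = s ^ 2 - u ^ 2 := by linarith
  have hv' : b ^ 2 = s ^ 2 - v ^ 2 := by linarith
  rw [kowalevskiSq, hu', hv']
  ring

/-! The line `σ - τ - 2 s x = c` through a vertex of the triangle, compared with the lines
`c² = 4 s² K`. -/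

theorem vertexA_sq (a b s τ : ℝ) : (a ^ 2 - b ^ 2 - τ) ^ 2 - kowalevskiSq a b s τ =
    4 * τ * (b ^ 2 - s ^ 2) := by
  unfold kowalevskiSq; ring

theorem vertexB_sq (a b s τ : ℝ) :
    ((a - b) ^ 2 - τ - 2 * s * (a - b)) ^ 2 - kowalevskiSq a b s τ =
      4 * ((a - b) ^ 2 - τ) * ((s - a) * (s + b)) := by
  unfold kowalevskiSq; ring

theorem vertexC_sq (a b s τ : ℝ) :
    ((a + b) ^ 2 - τ - 2 * s * (a + b)) ^ 2 - kowalevskiSq a b s τ =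
      4 * ((a + b) ^ 2 - τ) * ((s - a) * (s - b)) := by
  unfold kowalevskiSq; ring

theorem sqrt_lt_of_lt_sq {v N : ℝ} (hN : 0 ≤ N) (hv : 0 ≤ v) (h : N < v ^ 2) : √N < v :=
  (Real.sqrt_lt_sqrt hN h).trans_eq (Real.sqrt_sq hv)

theorem lt_neg_sqrt_of_lt_sq {v N : ℝ} (hN : 0 ≤ N) (hv : v ≤ 0) (h : N < v ^ 2) : v < -√N := by
  have := sqrt_lt_of_lt_sq hN (neg_nonneg.2 hv) (by rwa [neg_sq])
  linarith

theorem le_sqrt_mul_sqrt {c A B : ℝ} (hA : 0 ≤ A) (h : c ^ 2 ≤ A * B) : c ≤ √A * √B := by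
  rw [← Real.sqrt_mul hA]
  exact Real.le_sqrt_of_sq_le h

/-- No points for `s < -a`: the part `σ < τ` of the triangle lies strictly above the line
`σ - τ + 2 s x = -2 |s| √K`. -/
theorem InTriangle.not_lt_neg (hb : 0 < b) (hab : b < a) (h : InTriangle a b x σ)
    (hx : 0 ≤ x) (hsa : s < -a) (hτσ : σ < τ)
    (h2 : kowalevskiSq a b s τ ≤ (σ - τ + 2 * s * x) ^ 2) : False := by
  have hτ : (a - b) ^ 2 < τ := by linarith [h.sq_le hb hab]
  have hs : s < 0 := by linarith
  have hlow : σ - τ + 2 * s * x ≤ -√(kowalevskiSq a b s τ) := by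
    have := (Real.sqrt_le_sqrt h2).trans_eq (Real.sqrt_sq_eq_abs _)
    rw [abs_of_nonpos (by nlinarith)] at this
    linarith
  rcases le_or_gt τ ((a + b) ^ 2) with hτ2 | hτ2
  · have hk : -(s / a) * (τ + (a ^ 2 - b ^ 2)) ≤ √(kowalevskiSq a b s τ) := by
      refine Real.le_sqrt_of_sq_le ?_
      have ha : 0 < a := by linarith
      rw [← sub_nonneg]
      have : kowalevskiSq a b s τ - (-(s / a) * (τ + (a ^ 2 - b ^ 2))) ^ 2 =
          (s ^ 2 - a ^ 2) * ((τ - (a - b) ^ 2) * ((a + b) ^ 2 - τ)) / a ^ 2 := by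
        unfold kowalevskiSq
        field_simp
        ring
      rw [this]
      have e1 : 0 ≤ s ^ 2 - a ^ 2 := by nlinarith
      have e2 : 0 ≤ τ - (a - b) ^ 2 := by linarith
      have e3 : 0 ≤ (a + b) ^ 2 - τ := by linarith
      positivity
    have ha : 0 < a := by linarith
    have hm : 1 < -(s / a) := by rw [← neg_div, lt_div_iff₀ ha]; linarith
    obtain ⟨m, hm'⟩ : ∃ m, m = -(s / a) := ⟨_, rfl⟩
    have hsm : s = -m * a := by rw [hm']; field_simp
    rw [← hm'] at hm hk
    rw [hsm] at hlow hk
    have h3 := h.ge_right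
    -- with `r² = a² - b²`, `σ - τ - 2 m a x + k` is the sum of `m (σ + r² - 2 a x)`,
    -- `(m - 1) (τ - σ)` and `k - m (τ + r²)`
    nlinarith [mul_nonneg (by linarith : 0 ≤ m) (sub_nonneg.2 h3),
      mul_pos (sub_pos.2 hm) (sub_pos.2 hτσ)]
  · have hneg : ∀ v : ℝ, v ^ 2 < kowalevskiSq a b s τ → -√(kowalevskiSq a b s τ) < v :=
      fun v hv => by
        have := Real.sqrt_lt_sqrt (sq_nonneg v) hv
        rw [Real.sqrt_sq_eq_abs] at this
        linarith [neg_abs_le v]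
    have vA := hneg (a ^ 2 - b ^ 2 - τ) (by
      have := vertexA_sq a b s τ
      have : 0 < τ * (s ^ 2 - b ^ 2) := mul_pos (by nlinarith) (by nlinarith)
      linarith)
    have vB := hneg ((a - b) ^ 2 - τ + 2 * s * (a - b)) (by
      have h0 := vertexB_sq a b (-s) τ
      have hE : kowalevskiSq a b (-s) τ = kowalevskiSq a b s τ := by
        unfold kowalevskiSq; ring
      rw [hE] at h0
      have : 0 < (τ - (a - b) ^ 2) * ((-s - a) * (-s + b)) :=
        mul_pos (by linarith) (mul_pos (by linarith) (by linarith))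
      nlinarith)
    have vC := hneg ((a + b) ^ 2 - τ + 2 * s * (a + b)) (by
      have h0 := vertexC_sq a b (-s) τ
      have hE : kowalevskiSq a b (-s) τ = kowalevskiSq a b s τ := by
        unfold kowalevskiSq; ring
      rw [hE] at h0
      have : 0 < (τ - (a + b) ^ 2) * ((-s - a) * (-s - b)) :=
        mul_pos (by linarith) (mul_pos (by linarith) (by linarith))
      nlinarith)
    have := h.pos_of_vertices hb hab (u := 2 * s) (v := 1)
      (c := -τ + √(kowalevskiSq a b s τ)) (by linarith) (by linarith) (by linarith)
    linarith

/-- Otherwise `τ` is at most the smaller root of the quadratic `4 s² K`, and all three vertices lie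
strictly above the strip `|σ - τ - 2 s x| ≤ 2 |s| √K`. -/
theorem InTriangle.left_bound (hb : 0 < b) (hab : b < a) (h : InTriangle a b x σ)
    (hN : 0 ≤ kowalevskiSq a b s τ)
    (hstrip : |σ - τ - 2 * s * x| ≤ √(kowalevskiSq a b s τ))
    (hsb : -b < s) (hs : s < 0) (hτ : (a - b) ^ 2 < τ) :
    (√(a ^ 2 - s ^ 2) + √(b ^ 2 - s ^ 2)) ^ 2 ≤ τ := by
  by_contra! hlt
  have hab2 : b ^ 2 < a ^ 2 := by nlinarith
  replace hstrip := abs_le.1 hstrip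
  have hsb2 : s ^ 2 < b ^ 2 := by nlinarith
  have hfac := kowalevskiSq_factor_inner (τ := τ) hsb2.le (hsb2.le.trans hab2.le)
  have huv := le_sqrt_mul_sqrt (c := (a - s) * (s + b)) (A := a ^ 2 - s ^ 2)
    (B := b ^ 2 - s ^ 2) (by linarith) (by
      have : 0 ≤ (a - s) * (b + s) * (2 * (-s) * (a - b)) := by
        have h1 : 0 ≤ a - s := by linarith
        have h2 : 0 ≤ b + s := by linarith
        have h3 : 0 ≤ -s := by linarith
        have h4 : 0 ≤ a - b := by linarith
        positivity
      linarith)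
  have hu := Real.sq_sqrt (show 0 ≤ a ^ 2 - s ^ 2 by linarith)
  have hv := Real.sq_sqrt (show 0 ≤ b ^ 2 - s ^ 2 by linarith)
  have hu0 := Real.sqrt_nonneg (a ^ 2 - s ^ 2)
  have hv0 := Real.sqrt_nonneg (b ^ 2 - s ^ 2)
  have huv' := Real.sqrt_le_sqrt (show b ^ 2 - s ^ 2 ≤ a ^ 2 - s ^ 2 by linarith)
  generalize √(a ^ 2 - s ^ 2) = u at *
  generalize √(b ^ 2 - s ^ 2) = v at *
  have hle : τ ≤ (u - v) ^ 2 := by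
    by_contra! hgt
    rw [hfac] at hN
    nlinarith [mul_pos (sub_pos.2 hlt) (sub_pos.2 hgt)]
  have vA := sqrt_lt_of_lt_sq hN (v := a ^ 2 - b ^ 2 - τ)
    (by linarith [mul_nonneg hv0 (sub_nonneg.2 huv')]) (by
    have := vertexA_sq a b s τ
    have : 0 < τ * (b ^ 2 - s ^ 2) := mul_pos (by nlinarith) (by linarith)
    linarith)
  have vB := sqrt_lt_of_lt_sq hN (v := (a - b) ^ 2 - τ - 2 * s * (a - b)) (by nlinarith) (by
    have := vertexB_sq a b s τ
    have : 0 < (τ - (a - b) ^ 2) * ((a - s) * (s + b)) :=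
      mul_pos (by linarith) (mul_pos (by linarith) (by linarith))
    linarith)
  have hτ2 : τ < (a + b) ^ 2 := by nlinarith
  have vC := sqrt_lt_of_lt_sq hN (v := (a + b) ^ 2 - τ - 2 * s * (a + b)) (by nlinarith) (by
    have := vertexC_sq a b s τ
    have : 0 < ((a + b) ^ 2 - τ) * ((a - s) * (b - s)) :=
      mul_pos (by linarith) (mul_pos (by linarith) (by linarith))
    linarith)
  have := h.pos_of_vertices hb hab (u := -2 * s) (v := 1)
      (c := -τ - √(kowalevskiSq a b s τ)) (by linarith) (by linarith) (by linarith)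
  linarith

/-- Otherwise `τ` is at least the larger root of the quadratic `4 s² K`, and all three vertices lie
strictly below the strip `|σ - τ - 2 s x| ≤ 2 |s| √K`. -/
theorem InTriangle.right_inner_bound (hb : 0 < b) (hab : b < a) (h : InTriangle a b x σ)
    (hN : 0 ≤ kowalevskiSq a b s τ)
    (hstrip : |σ - τ - 2 * s * x| ≤ √(kowalevskiSq a b s τ))
    (hs : 0 < s) (hsb : s < b) (hτ : τ < (a + b) ^ 2) :
    τ ≤ (√(a ^ 2 - s ^ 2) - √(b ^ 2 - s ^ 2)) ^ 2 := by
  by_contra! hlt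
  have hab2 : b ^ 2 < a ^ 2 := by nlinarith
  replace hstrip := abs_le.1 hstrip
  have hsb2 : s ^ 2 < b ^ 2 := by nlinarith
  have hfac := kowalevskiSq_factor_inner (τ := τ) hsb2.le (hsb2.le.trans hab2.le)
  have huv := le_sqrt_mul_sqrt (c := (a - s) * (b - s)) (A := a ^ 2 - s ^ 2)
    (B := b ^ 2 - s ^ 2) (by linarith) (by
      have : 0 ≤ (a - s) * (b - s) * (2 * s * (a + b)) := by
        have h1 : 0 ≤ a - s := by linarith
        have h2 : 0 ≤ b - s := by linarith
        have h4 : 0 ≤ a + b := by linarith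
        positivity
      linarith)
  have hu := Real.sq_sqrt (show 0 ≤ a ^ 2 - s ^ 2 by linarith)
  have hv := Real.sq_sqrt (show 0 ≤ b ^ 2 - s ^ 2 by linarith)
  have hu0 := Real.sqrt_nonneg (a ^ 2 - s ^ 2)
  have hv0 := Real.sqrt_nonneg (b ^ 2 - s ^ 2)
  have huv' := Real.sqrt_le_sqrt (show b ^ 2 - s ^ 2 ≤ a ^ 2 - s ^ 2 by linarith)
  generalize √(a ^ 2 - s ^ 2) = u at *
  generalize √(b ^ 2 - s ^ 2) = v at *
  have hle : (u + v) ^ 2 ≤ τ := by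
    by_contra! hgt
    rw [hfac] at hN
    nlinarith [mul_pos (sub_pos.2 hlt) (sub_pos.2 hgt)]
  have hr : a ^ 2 - b ^ 2 ≤ τ := by nlinarith
  have hτB : (a - b) ^ 2 < τ := by nlinarith
  have vA := lt_neg_sqrt_of_lt_sq hN (v := a ^ 2 - b ^ 2 - τ) (by linarith) (by
    have := vertexA_sq a b s τ
    have : 0 < τ * (b ^ 2 - s ^ 2) := mul_pos (by nlinarith) (by linarith)
    linarith)
  have vB := lt_neg_sqrt_of_lt_sq hN (v := (a - b) ^ 2 - τ - 2 * s * (a - b))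
    (by nlinarith) (by
    have := vertexB_sq a b s τ
    have : 0 < (τ - (a - b) ^ 2) * ((a - s) * (s + b)) :=
      mul_pos (by linarith) (mul_pos (by linarith) (by linarith))
    linarith)
  have vC := lt_neg_sqrt_of_lt_sq hN (v := (a + b) ^ 2 - τ - 2 * s * (a + b))
    (by nlinarith) (by
    have := vertexC_sq a b s τ
    have : 0 < ((a + b) ^ 2 - τ) * ((a - s) * (b - s)) :=
      mul_pos (by linarith) (mul_pos (by linarith) (by linarith))
    linarith)
  have := h.pos_of_vertices hb hab (u := 2 * s) (v := -1)
      (c := τ - √(kowalevskiSq a b s τ)) (by linarith) (by linarith) (by linarith)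
  linarith

/-- Otherwise `τ` is at most the smaller root of the quadratic `4 s² K`, and all three vertices lie
strictly above the strip `|σ - τ - 2 s x| ≤ 2 |s| √K`. -/
theorem InTriangle.right_outer_bound (hb : 0 < b) (hab : b < a) (h : InTriangle a b x σ)
    (hN : 0 ≤ kowalevskiSq a b s τ)
    (hstrip : |σ - τ - 2 * s * x| ≤ √(kowalevskiSq a b s τ))
    (hsa : a < s) (hτ : τ < (a + b) ^ 2) :
    -(√(s ^ 2 - b ^ 2) - √(s ^ 2 - a ^ 2)) ^ 2 ≤ τ := by
  by_contra! hlt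
  have hsb : b ≤ s := by linarith
  have hab2 : b ^ 2 < a ^ 2 := by nlinarith
  replace hstrip := abs_le.1 hstrip
  have hsa2 : a ^ 2 < s ^ 2 := by nlinarith
  have hfac := kowalevskiSq_factor_outer (τ := τ) (hab2.le.trans hsa2.le) hsa2.le
  have hu := Real.sq_sqrt (show 0 ≤ s ^ 2 - a ^ 2 by linarith)
  have hv := Real.sq_sqrt (show 0 ≤ s ^ 2 - b ^ 2 by linarith)
  have hu0 := Real.sqrt_nonneg (s ^ 2 - a ^ 2)
  have hv0 := Real.sqrt_nonneg (s ^ 2 - b ^ 2)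
  generalize √(s ^ 2 - a ^ 2) = u at *
  generalize √(s ^ 2 - b ^ 2) = v at *
  have hle : τ ≤ -(v + u) ^ 2 := by
    by_contra! hgt
    rw [hfac] at hN
    nlinarith
  have huv := mul_nonneg hu0 hv0
  have hτ0 : τ < 0 := by nlinarith
  have vA := sqrt_lt_of_lt_sq hN (v := a ^ 2 - b ^ 2 - τ) (by linarith) (by
    have := vertexA_sq a b s τ
    have : 0 < -τ * (s ^ 2 - b ^ 2) := mul_pos (by linarith) (by linarith)
    linarith)
  have vB := sqrt_lt_of_lt_sq hN (v := (a - b) ^ 2 - τ - 2 * s * (a - b)) (by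
      nlinarith [mul_nonneg (sub_nonneg.2 hsa.le) (by linarith : 0 ≤ s + b)]) (by
    have := vertexB_sq a b s τ
    have : 0 < ((a - b) ^ 2 - τ) * ((s - a) * (s + b)) :=
      mul_pos (by nlinarith) (mul_pos (by linarith) (by linarith))
    linarith)
  have vC := sqrt_lt_of_lt_sq hN (v := (a + b) ^ 2 - τ - 2 * s * (a + b)) (by
      nlinarith [mul_nonneg (sub_nonneg.2 hsa.le) (sub_nonneg.2 hsb)]) (by
    have := vertexC_sq a b s τ
    have : 0 < ((a + b) ^ 2 - τ) * ((s - a) * (s - b)) :=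
      mul_pos (by linarith) (mul_pos (by linarith) (by linarith))
    linarith)
  have := h.pos_of_vertices hb hab (u := -2 * s) (v := 1)
      (c := -τ - √(kowalevskiSq a b s τ)) (by linarith) (by linarith) (by linarith)
  linarith

/-- A point of the triangle with `|σ - τ - 2 s x| ≤ 2 |s| √K ≤ |σ - τ| + 2 |s| x` and `σ - τ` of the
sign of `s` exists only for `(s, τ)` in the admissible region, off the pendulum edges. -/
theorem InTriangle.mem_admissibleRegion (hb : 0 < b) (hab : b < a) (h : InTriangle a b x σ)
    (hx : 0 ≤ x) (hD : 0 < s * (σ - τ))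
    (h1 : (σ - τ - 2 * s * x) ^ 2 ≤ kowalevskiSq a b s τ)
    (h2 : kowalevskiSq a b s τ ≤ (σ - τ + 2 * s * x) ^ 2) :
    (s, τ) ∈ admissibleRegion a b \ pendulumEdges a b := by
  have hσ1 := h.le_sq hb hab
  have hσ2 := h.sq_le hb hab
  have hN : 0 ≤ kowalevskiSq a b s τ := (sq_nonneg _).trans h1
  have hstrip := Real.abs_le_sqrt h1
  have hs0 : s ≠ 0 := by rintro rfl; simp at hD
  rcases hs0.lt_or_gt with hs | hs
  · have hτσ : σ < τ := by nlinarith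
    have hτ : (a - b) ^ 2 < τ := by linarith
    refine ⟨?_, ?_⟩
    · rcases lt_or_ge s (-a) with hsa | hsa
      · exact (h.not_lt_neg hb hab hx hsa hτσ h2).elim
      rcases le_or_gt s (-b) with hsb | hsb
      · exact Or.inl (Or.inl (Or.inl (Or.inl ⟨hsa, hsb, hτ.le⟩)))
      · exact Or.inl (Or.inl (Or.inl (Or.inr
          ⟨hsb.le, hs, h.left_bound hb hab hN hstrip hsb hs hτ⟩)))
    · rintro (⟨-, -, h⟩ | ⟨h, -⟩)
      · exact hτ.ne' h
      · simp only at h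
        linarith
  · have hτσ : τ < σ := by nlinarith
    have hτ : τ < (a + b) ^ 2 := by linarith
    refine ⟨?_, ?_⟩
    · rcases lt_or_ge s b with hsb | hsb
      · exact Or.inl (Or.inl (Or.inr
          ⟨hs, hsb.le, h.right_inner_bound hb hab hN hstrip hs hsb hτ⟩))
      rcases le_or_gt s a with hsa | hsa
      · exact Or.inl (Or.inr ⟨hsb, hsa, hτ.le⟩)
      · exact Or.inr ⟨hsa.le, h.right_outer_bound hb hab hN hstrip hsa hτ, hτ.le⟩
    · rintro (⟨-, h, -⟩ | ⟨-, h⟩)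
      · simp only at h
        linarith
      · exact hτ.ne h

/-! ### Necessary conditions for regular points -/

/-- The sides of the triangle are the lines where `α₃ = 0` or `β₃ = 0`. -/
theorem inTriangle_of_mem (hb : 0 < b) (hab : b < a) (hq : q ∈ phaseSpace a b) :
    InTriangle a b √((q.α₁ - q.β₂) ^ 2 + (q.α₂ + q.β₁) ^ 2)
      (((q.α₁ - q.β₂) ^ 2 + (q.α₂ + q.β₁) ^ 2) + (q.α₃ ^ 2 + q.β₃ ^ 2)) := by
  have hσ := normSq_add_normSq hq
  have hγ := cross_third_sq hq
  have hX : 0 ≤ (q.α₁ - q.β₂) ^ 2 + (q.α₂ + q.β₁) ^ 2 := by positivity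
  have hx := Real.sq_sqrt hX
  have hx0 := Real.sqrt_nonneg ((q.α₁ - q.β₂) ^ 2 + (q.α₂ + q.β₁) ^ 2)
  have hr : 0 ≤ a ^ 2 - b ^ 2 := by nlinarith
  have hZ : 0 ≤ q.α₃ ^ 2 + q.β₃ ^ 2 := by positivity
  generalize (q.α₁ - q.β₂) ^ 2 + (q.α₂ + q.β₁) ^ 2 = X at *
  generalize √X = x at *
  generalize q.α₁ * q.β₂ - q.α₂ * q.β₁ = g at *
  obtain ⟨z, hz⟩ : ∃ z, z = X + (q.α₃ ^ 2 + q.β₃ ^ 2) := ⟨_, rfl⟩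
  rw [← hz] at hσ ⊢
  have hXz : X = z - (q.α₃ ^ 2 + q.β₃ ^ 2) := by linarith
  have i1 : (z - (a ^ 2 - b ^ 2)) ^ 2 ≤ (2 * b * x) ^ 2 := by
    have : (2 * b * x) ^ 2 - (z - (a ^ 2 - b ^ 2)) ^ 2 = 4 * ((a ^ 2 - b ^ 2) * q.β₃ ^ 2) := by
      rw [mul_pow, hx, hXz, hσ]
      linear_combination -4 * hγ
    nlinarith [mul_nonneg hr (sq_nonneg q.β₃)]
  have i2 : (2 * a * x) ^ 2 ≤ (z + (a ^ 2 - b ^ 2)) ^ 2 := by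
    have : (z + (a ^ 2 - b ^ 2)) ^ 2 - (2 * a * x) ^ 2 = 4 * ((a ^ 2 - b ^ 2) * q.α₃ ^ 2) := by
      rw [mul_pow, hx, hXz, hσ]
      linear_combination 4 * hγ
    nlinarith [mul_nonneg hr (sq_nonneg q.α₃)]
  have j1 := abs_le.1 (abs_le_of_sq_le_sq i1 (by positivity))
  have j2 := (abs_le.1 (abs_le_of_sq_le_sq i2 (by linarith))).2
  exact ⟨by linarith [j1.2], by linarith [j1.1], by linarith⟩

/-- `√K`, `|x₁|` and `|w₁|²` are the sides of a triangle, since `K = |w₁² + x₁|²`. -/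
theorem K_bounds (q : State) :
    (q.ω₁ ^ 2 + q.ω₂ ^ 2 - √((q.α₁ - q.β₂) ^ 2 + (q.α₂ + q.β₁) ^ 2)) ^ 2 ≤ q.K ∧
    q.K ≤ (q.ω₁ ^ 2 + q.ω₂ ^ 2 + √((q.α₁ - q.β₂) ^ 2 + (q.α₂ + q.β₁) ^ 2)) ^ 2 := by
  have hX : 0 ≤ (q.α₁ - q.β₂) ^ 2 + (q.α₂ + q.β₁) ^ 2 := by positivity
  have hx := Real.sq_sqrt hX
  have hx0 := Real.sqrt_nonneg ((q.α₁ - q.β₂) ^ 2 + (q.α₂ + q.β₁) ^ 2)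
  unfold State.K
  generalize √((q.α₁ - q.β₂) ^ 2 + (q.α₂ + q.β₁) ^ 2) = x at *
  have hcs : ((q.ω₁ ^ 2 - q.ω₂ ^ 2) * (q.α₁ - q.β₂) + 2 * q.ω₁ * q.ω₂ * (q.α₂ + q.β₁)) ^ 2 ≤
      ((q.ω₁ ^ 2 + q.ω₂ ^ 2) * x) ^ 2 := by
    rw [mul_pow, hx]
    nlinarith [sq_nonneg ((q.ω₁ ^ 2 - q.ω₂ ^ 2) * (q.α₂ + q.β₁) -
      2 * q.ω₁ * q.ω₂ * (q.α₁ - q.β₂))]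
  have h := abs_le.1 (abs_le_of_sq_le_sq hcs (by positivity))
  constructor
  · linarith [h.1]
  · linarith [h.2]

theorem mem_admissibleRegion_of_defect (hb : 0 < b) (hab : b < a) (hq : q ∈ phaseSpace a b)
    (hw : q.w₁ ≠ 0) (h : q.defect s τ = 0) :
    (s, τ) ∈ admissibleRegion a b \ pendulumEdges a b := by
  have hs := s_ne_zero_of_defect (hb.trans hab) hb hq hw h
  have hW := (w₁_ne_zero_iff q).1 hw
  have hK := (integrals_of_defect hq hw h).2
  obtain ⟨-, -, -, -, e4⟩ := (defect_eq_zero_iff _ _ _).1 h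
  have hT := inTriangle_of_mem hb hab hq
  obtain ⟨k1, k2⟩ := K_bounds q
  have hx0 := Real.sqrt_nonneg ((q.α₁ - q.β₂) ^ 2 + (q.α₂ + q.β₁) ^ 2)
  generalize √((q.α₁ - q.β₂) ^ 2 + (q.α₂ + q.β₁) ^ 2) = x at *
  have hD : (q.α₁ - q.β₂) ^ 2 + (q.α₂ + q.β₁) ^ 2 + (q.α₃ ^ 2 + q.β₃ ^ 2) - τ =
      2 * s * (q.ω₁ ^ 2 + q.ω₂ ^ 2) := by linarith
  have hs2 : 0 < s ^ 2 := by positivity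
  refine hT.mem_admissibleRegion hb hab hx0 ?_ ?_ ?_
  · rw [hD]
    have := mul_pos hs2 hW
    linarith
  · rw [hD, kowalevskiSq, ← hK]
    linarith [mul_le_mul_of_nonneg_left k1 hs2.le]
  · rw [hD, kowalevskiSq, ← hK]
    linarith [mul_le_mul_of_nonneg_left k2 hs2.le]

/-! ### Points over the admissible region -/

/-- A point of `𝔒` with `α` along the first axis, from a root `x` of a quadratic equation with
discriminant `4 s² K`. Here `x = α₁ - β₂`. -/
theorem exists_point_axis₁ (hs : s ≠ 0) {x : ℝ} (h1 : a - b ≤ x) (h2 : x ≤ a + b)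
    (hD : 0 < (2 * a * x - (a ^ 2 - b ^ 2) - τ) / (2 * s))
    (hx : (a - s) * x ^ 2 - (a ^ 2 - b ^ 2 + τ) * x + τ * (a + s) = 0) :
    ∃ q ∈ phaseSpace a b, q.w₁ ≠ 0 ∧ q.defect s τ = 0 := by
  have hζ := Real.sq_sqrt (show 0 ≤ b ^ 2 - (a - x) ^ 2 by nlinarith)
  generalize √(b ^ 2 - (a - x) ^ 2) = ζ at hζ
  have hω := Real.sq_sqrt hD.le
  have hω0 := (Real.sqrt_pos.2 hD).ne'
  generalize √((2 * a * x - (a ^ 2 - b ^ 2) - τ) / (2 * s)) = ω at hω hω0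
  rw [eq_div_iff (by positivity)] at hω
  refine ⟨⟨0, ω, -((a + s) * ζ) / (s * ω), a, 0, 0, 0, a - x, ζ⟩, ⟨?_, ?_, ?_⟩, ?_, ?_⟩
  · simp
  · simp only; linarith
  · simp
  · rw [w₁_ne_zero_iff]; simp only; positivity
  · rw [defect_eq_zero_iff]
    refine ⟨?_, ?_, ?_, ?_, ?_⟩
    · simp [Mα]
    · simp only [Mβ]
      field_simp
      linear_combination (a + s - x) * hω - (a + s) * hζ - hx
    · simp
    · simp only
      field_simp
      ring
    · simp only
      linear_combination hω - hζ

/-- A point of `𝔒` with `β` along the second axis; here `x = β₂ - α₁`. -/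
theorem exists_point_axis₂ (hs : s ≠ 0) {x : ℝ} (h1 : b - a ≤ x) (h2 : x ≤ a + b)
    (hD : 0 < (a ^ 2 - b ^ 2 + 2 * b * x - τ) / (2 * s))
    (hx : (s - b) * x ^ 2 - (a ^ 2 - b ^ 2 - τ) * x - τ * (s + b) = 0) :
    ∃ q ∈ phaseSpace a b, q.w₁ ≠ 0 ∧ q.defect s τ = 0 := by
  have hζ := Real.sq_sqrt (show 0 ≤ a ^ 2 - (b - x) ^ 2 by nlinarith)
  generalize √(a ^ 2 - (b - x) ^ 2) = ζ at hζ
  have hω := Real.sq_sqrt hD.le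
  have hω0 := (Real.sqrt_pos.2 hD).ne'
  generalize √((a ^ 2 - b ^ 2 + 2 * b * x - τ) / (2 * s)) = ω at hω hω0
  rw [eq_div_iff (by positivity)] at hω
  refine ⟨⟨ω, 0, -((b + s) * ζ) / (s * ω), b - x, 0, ζ, 0, b, 0⟩, ⟨?_, ?_, ?_⟩, ?_, ?_⟩
  · simp only; linarith
  · simp
  · simp
  · rw [w₁_ne_zero_iff]; simp only; positivity
  · rw [defect_eq_zero_iff]
    refine ⟨?_, ?_, ?_, ?_, ?_⟩
    · simp only [Mα]
      field_simp
      linear_combination (b + s - x) * hω - (b + s) * hζ + hx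
    · simp [Mβ]
    · simp only
      field_simp
      ring
    · simp
    · simp only
      linear_combination hω - hζ

/-- A point of `𝔒` with `α` and `β` in the plane of `e₁` and `e₂` and `ω₃ = 0`. The parameter
`b' = ± b` is the orientation, and `c` is the cosine of the angle between `α` and `e₁`. -/
theorem exists_point_planar {b' : ℝ} (hb' : b' ^ 2 = b ^ 2) {c : ℝ} (hc : c ^ 2 ≤ 1)
    (hsc : s ^ 2 - a * b' + s * (a - b') * c = 0) (hs : s ≠ 0)
    (hD : 0 < ((a + b') ^ 2 - τ) / (2 * s)) :
    ∃ q ∈ phaseSpace a b, q.w₁ ≠ 0 ∧ q.defect s τ = 0 := by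
  have hd := Real.sq_sqrt (sub_nonneg.2 hc)
  generalize √(1 - c ^ 2) = d at hd
  -- the kernel of the matrix of the linear equations for `(ω₁, ω₂)`
  obtain ⟨u, v, huv, k1, k2⟩ : ∃ u v : ℝ, 0 < u ^ 2 + v ^ 2 ∧
      (a * c + s) * u + a * d * v = 0 ∧ b' * d * u + (s - b' * c) * v = 0 := by
    by_cases h0 : 0 < (a * d) ^ 2 + (a * c + s) ^ 2
    · refine ⟨a * d, -(a * c + s), by linarith [neg_sq (a * c + s)], by ring, ?_⟩
      linear_combination a * b' * hd - hsc
    · have h1 : a * d = 0 := by nlinarith [sq_nonneg (a * d), sq_nonneg (a * c + s)]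
      have h2 : a * c + s = 0 := by nlinarith [sq_nonneg (a * d), sq_nonneg (a * c + s)]
      by_cases h3 : 0 < (s - b' * c) ^ 2 + (b' * d) ^ 2
      · exact ⟨s - b' * c, -(b' * d), by linarith [neg_sq (b' * d)], by rw [h1, h2]; ring, by ring⟩
      · have h4 : b' * d = 0 := by nlinarith [sq_nonneg (s - b' * c), sq_nonneg (b' * d)]
        have h5 : s - b' * c = 0 := by nlinarith [sq_nonneg (s - b' * c), sq_nonneg (b' * d)]
        exact ⟨1, 0, by norm_num, by rw [h1, h2]; ring, by rw [h4]; ring⟩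
  obtain ⟨t, ht0, ht⟩ : ∃ t : ℝ, 0 < t ∧
      t ^ 2 * (u ^ 2 + v ^ 2) = ((a + b') ^ 2 - τ) / (2 * s) :=
    ⟨√(((a + b') ^ 2 - τ) / (2 * s) / (u ^ 2 + v ^ 2)), Real.sqrt_pos.2 (div_pos hD huv), by
      rw [Real.sq_sqrt (div_pos hD huv).le, div_mul_cancel₀ _ huv.ne']⟩
  rw [eq_div_iff (by positivity)] at ht
  refine ⟨⟨t * u, t * v, 0, a * c, a * d, 0, b' * d, -(b' * c), 0⟩, ⟨?_, ?_, ?_⟩, ?_, ?_⟩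
  · simp only; linear_combination a ^ 2 * hd
  · simp only; linear_combination b' ^ 2 * hd + hb'
  · simp only; ring
  · rw [w₁_ne_zero_iff]
    simp only
    have := mul_pos (pow_pos ht0 2) huv
    linarith [mul_pow t u 2, mul_pow t v 2]
  · rw [defect_eq_zero_iff]
    refine ⟨?_, ?_, ?_, ?_, ?_⟩
    · simp only [Mα]; linear_combination 2 * t * k1
    · simp only [Mβ]; linear_combination 2 * t * k2
    · simp
    · simp
    · simp only; linear_combination ht - (a + b') ^ 2 * hd

theorem exists_point_planar_of_mem {b' : ℝ} (hb' : b' ^ 2 = b ^ 2) (hab : a - b' ≠ 0)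
    (h : 0 ≤ (a ^ 2 - s ^ 2) * (s ^ 2 - b ^ 2)) (hs : s ≠ 0)
    (hD : 0 < ((a + b') ^ 2 - τ) / (2 * s)) :
    ∃ q ∈ phaseSpace a b, q.w₁ ≠ 0 ∧ q.defect s τ = 0 := by
  refine exists_point_planar (c := (a * b' - s ^ 2) / (s * (a - b'))) hb' ?_ ?_ hs hD
  · rw [div_pow, div_le_one (by positivity)]
    rw [← hb'] at h
    linarith
  · field_simp
    ring

/-- The boundary edge of the triangle opposite to `(0, a² - b²)` is crossed by a line
`σ - τ - 2 s x = k` with `k² = 4 s² K`. -/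
theorem exists_point_of_crossing₁ (hs : s ≠ 0) (hsa : s < a) {k : ℝ}
    (hk : k ^ 2 = kowalevskiSq a b s τ) (h1 : (a - b) ^ 2 - τ - 2 * s * (a - b) ≤ k)
    (h2 : k ≤ (a + b) ^ 2 - τ - 2 * s * (a + b))
    (hD : ∀ x, a - b ≤ x → 0 < s * (k + 2 * s * x)) :
    ∃ q ∈ phaseSpace a b, q.w₁ ≠ 0 ∧ q.defect s τ = 0 := by
  have h0 : 0 < 2 * (a - s) := by linarith
  obtain ⟨x, hx⟩ : ∃ x, 2 * (a - s) * x = a ^ 2 - b ^ 2 + τ + k :=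
    ⟨(a ^ 2 - b ^ 2 + τ + k) / (2 * (a - s)), mul_div_cancel₀ _ h0.ne'⟩
  have hx1 : a - b ≤ x := le_of_mul_le_mul_left (by linarith) h0
  have hx2 : x ≤ a + b := le_of_mul_le_mul_left (by linarith) h0
  refine exists_point_axis₁ hs hx1 hx2 ?_ ?_
  · have hs2 : 0 < s ^ 2 := by positivity
    have : (2 * a * x - (a ^ 2 - b ^ 2) - τ) / (2 * s) = s * (k + 2 * s * x) / (2 * s ^ 2) := by
      field_simp
      linear_combination hx
    rw [this]
    exact div_pos (hD x hx1) (by positivity)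
  · refine (mul_eq_zero.1 ?_).resolve_left h0.ne'
    rw [kowalevskiSq] at hk
    linear_combination
      (1 / 2) * (2 * (a - s) * x - (a ^ 2 - b ^ 2 + τ) + k) * hx + (1 / 2) * hk

theorem exists_point_region₂ (hb : 0 < b) (hab : b < a) (hsb : -b ≤ s) (hs : s < 0)
    (hτ : (√(a ^ 2 - s ^ 2) + √(b ^ 2 - s ^ 2)) ^ 2 ≤ τ) :
    ∃ q ∈ phaseSpace a b, q.w₁ ≠ 0 ∧ q.defect s τ = 0 := by
  have hab2 : b ^ 2 < a ^ 2 := by nlinarith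
  have hsb2 : s ^ 2 ≤ b ^ 2 := by nlinarith
  have hfac := kowalevskiSq_factor_inner (τ := τ) hsb2 (hsb2.trans hab2.le)
  have hu := Real.sq_sqrt (show 0 ≤ a ^ 2 - s ^ 2 by linarith)
  have hv := Real.sq_sqrt (show 0 ≤ b ^ 2 - s ^ 2 by linarith)
  have hu0 := Real.sqrt_nonneg (a ^ 2 - s ^ 2)
  have hv0 := Real.sqrt_nonneg (b ^ 2 - s ^ 2)
  have huv := Real.sqrt_le_sqrt (show b ^ 2 - s ^ 2 ≤ a ^ 2 - s ^ 2 by linarith)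
  have hprod := mul_nonneg hu0 hv0
  generalize √(a ^ 2 - s ^ 2) = u at *
  generalize √(b ^ 2 - s ^ 2) = v at *
  have hN : 0 ≤ kowalevskiSq a b s τ := by
    rw [hfac]
    exact mul_nonneg (by linarith) (by linarith)
  have hk := Real.sq_sqrt hN
  have hk0 := Real.sqrt_nonneg (kowalevskiSq a b s τ)
  refine exists_point_of_crossing₁ (k := -√(kowalevskiSq a b s τ)) hs.ne (by linarith)
    (by rw [neg_sq, hk]) ?_ ?_ ?_
  · -- the vertex `(a - b, (a - b)²)` lies on or below the strip
    have h0 := vertexB_sq a b s τ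
    have hτr : a ^ 2 - b ^ 2 ≤ τ := by linarith [mul_nonneg hv0 hv0]
    have hτB : (a - b) ^ 2 ≤ τ := by nlinarith
    have hle : (a - b) ^ 2 - τ - 2 * s * (a - b) ≤ 0 := by
      have : 0 ≤ (a - s) * (s + b) := mul_nonneg (by linarith) (by linarith)
      linarith
    have : 0 ≤ (τ - (a - b) ^ 2) * ((a - s) * (s + b)) :=
      mul_nonneg (by linarith) (mul_nonneg (by linarith) (by linarith))
    have := Real.sqrt_le_sqrt (show kowalevskiSq a b s τ ≤
      ((a - b) ^ 2 - τ - 2 * s * (a - b)) ^ 2 by linarith)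
    rw [Real.sqrt_sq_eq_abs, abs_of_nonpos hle] at this
    linarith
  · -- the vertex `(a + b, (a + b)²)` lies in or above the strip
    have h0 := vertexC_sq a b s τ
    rcases le_or_gt τ ((a + b) ^ 2) with hτ2 | hτ2
    · have := mul_pos (neg_pos.2 hs) (by linarith : 0 < a + b)
      linarith
    · have : 0 ≤ (τ - (a + b) ^ 2) * ((a - s) * (b - s)) :=
        mul_nonneg (by linarith) (mul_nonneg (by linarith) (by linarith))
      exact (abs_le.1 (Real.abs_le_sqrt (show ((a + b) ^ 2 - τ - 2 * s * (a + b)) ^ 2 ≤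
        kowalevskiSq a b s τ by linarith))).1
  · intro x hx
    refine mul_pos_of_neg_of_neg hs ?_
    have := mul_pos (neg_pos.2 hs) (by linarith : 0 < x)
    linarith

theorem exists_point_region₃ (hb : 0 < b) (hab : b < a) (hs : 0 < s) (hsb : s ≤ b)
    (hτ : τ ≤ (√(a ^ 2 - s ^ 2) - √(b ^ 2 - s ^ 2)) ^ 2) :
    ∃ q ∈ phaseSpace a b, q.w₁ ≠ 0 ∧ q.defect s τ = 0 := by
  have hab2 : b ^ 2 < a ^ 2 := by nlinarith
  have hsb2 : s ^ 2 ≤ b ^ 2 := by nlinarith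
  have hfac := kowalevskiSq_factor_inner (τ := τ) hsb2 (hsb2.trans hab2.le)
  have huv := le_sqrt_mul_sqrt (c := s * (a + b) - a * b - s ^ 2) (A := a ^ 2 - s ^ 2)
    (B := b ^ 2 - s ^ 2) (by linarith) (by
      have : 0 ≤ (a - s) * (b - s) * (2 * s * (a + b)) := by
        have h1 : 0 ≤ a - s := by linarith
        have h2 : 0 ≤ b - s := by linarith
        have h4 : 0 ≤ a + b := by linarith
        positivity
      linarith)
  have huv' := le_sqrt_mul_sqrt (c := (a - s) * (b - s)) (A := a ^ 2 - s ^ 2)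
    (B := b ^ 2 - s ^ 2) (by linarith) (by
      have : 0 ≤ (a - s) * (b - s) * (2 * s * (a + b)) := by
        have h1 : 0 ≤ a - s := by linarith
        have h2 : 0 ≤ b - s := by linarith
        have h4 : 0 ≤ a + b := by linarith
        positivity
      linarith)
  have hu := Real.sq_sqrt (show 0 ≤ a ^ 2 - s ^ 2 by linarith)
  have hv := Real.sq_sqrt (show 0 ≤ b ^ 2 - s ^ 2 by linarith)
  have hu0 := Real.sqrt_nonneg (a ^ 2 - s ^ 2)
  have hv0 := Real.sqrt_nonneg (b ^ 2 - s ^ 2)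
  generalize √(a ^ 2 - s ^ 2) = u at *
  generalize √(b ^ 2 - s ^ 2) = v at *
  have hprod := mul_nonneg hu0 hv0
  have hN : 0 ≤ kowalevskiSq a b s τ := by
    rw [hfac]
    exact mul_nonneg_of_nonpos_of_nonpos (by linarith) (by linarith)
  have hk := Real.sq_sqrt hN
  have hk0 := Real.sqrt_nonneg (kowalevskiSq a b s τ)
  refine exists_point_of_crossing₁ (k := √(kowalevskiSq a b s τ)) hs.ne' (by linarith) hk
    ?_ ?_ ?_
  · -- the vertex `(a - b, (a - b)²)` lies in or below the strip
    have h0 := vertexB_sq a b s τ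
    rcases le_or_gt τ ((a - b) ^ 2) with hτ2 | hτ2
    · have : 0 ≤ ((a - b) ^ 2 - τ) * ((a - s) * (s + b)) :=
        mul_nonneg (by linarith) (mul_nonneg (by linarith) (by linarith))
      exact (abs_le.1 (Real.abs_le_sqrt (show ((a - b) ^ 2 - τ - 2 * s * (a - b)) ^ 2 ≤
        kowalevskiSq a b s τ by linarith))).2
    · have := mul_pos hs (sub_pos.2 hab)
      linarith
  · -- the vertex `(a + b, (a + b)²)` lies on or above the strip
    have h0 := vertexC_sq a b s τ
    have hle : 0 ≤ (a + b) ^ 2 - τ - 2 * s * (a + b) := by linarith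
    have hτC : τ ≤ (a + b) ^ 2 := by
      have := mul_pos hs (by linarith : 0 < a + b)
      linarith
    have : 0 ≤ ((a + b) ^ 2 - τ) * ((a - s) * (b - s)) :=
      mul_nonneg (by linarith) (mul_nonneg (by linarith) (by linarith))
    have := Real.sqrt_le_sqrt (show kowalevskiSq a b s τ ≤
      ((a + b) ^ 2 - τ - 2 * s * (a + b)) ^ 2 by linarith)
    rwa [Real.sqrt_sq hle] at this
  · intro x hx
    have := mul_pos hs (by linarith : 0 < x)
    exact mul_pos hs (by linarith)

theorem exists_point_region₅ (hb : 0 < b) (hab : b < a) (hsa : a < s)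
    (hτ : -(√(s ^ 2 - b ^ 2) - √(s ^ 2 - a ^ 2)) ^ 2 ≤ τ) (hτ2 : τ < (a + b) ^ 2) :
    ∃ q ∈ phaseSpace a b, q.w₁ ≠ 0 ∧ q.defect s τ = 0 := by
  have hab2 : b ^ 2 < a ^ 2 := by nlinarith
  have hsa2 : a ^ 2 < s ^ 2 := by nlinarith
  have hs : 0 < s := by linarith
  have hfac := kowalevskiSq_factor_outer (τ := τ) (hab2.le.trans hsa2.le) hsa2.le
  have huv := le_sqrt_mul_sqrt (c := (s - a) * (s - b)) (A := s ^ 2 - b ^ 2)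
    (B := s ^ 2 - a ^ 2) (by linarith) (by
      have : 0 ≤ (s - a) * (s - b) * (2 * s * (a + b)) := by
        have h1 : 0 ≤ s - a := by linarith
        have h2 : 0 ≤ s - b := by linarith
        have h4 : 0 ≤ a + b := by linarith
        positivity
      linarith)
  have hu := Real.sq_sqrt (show 0 ≤ s ^ 2 - a ^ 2 by linarith)
  have hv := Real.sq_sqrt (show 0 ≤ s ^ 2 - b ^ 2 by linarith)
  have hu0 := Real.sqrt_nonneg (s ^ 2 - a ^ 2)
  have hv0 := Real.sqrt_nonneg (s ^ 2 - b ^ 2)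
  generalize √(s ^ 2 - a ^ 2) = u at *
  generalize √(s ^ 2 - b ^ 2) = v at *
  have hprod := mul_nonneg hu0 hv0
  have hN : 0 ≤ kowalevskiSq a b s τ := by
    rw [hfac]
    exact mul_nonneg (by linarith) (by linarith)
  have hk := Real.sq_sqrt hN
  have hk0 := Real.sqrt_nonneg (kowalevskiSq a b s τ)
  have hA := vertexA_sq a b s τ
  have hC := vertexC_sq a b s τ
  have hkA : -(a ^ 2 - b ^ 2 - τ) ≤ √(kowalevskiSq a b s τ) := by
    rcases le_or_gt τ 0 with h | h
    · linarith
    · have := mul_pos h (by linarith : 0 < s ^ 2 - b ^ 2)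
      exact neg_le.1 (abs_le.1 (Real.abs_le_sqrt (show (a ^ 2 - b ^ 2 - τ) ^ 2 ≤
        kowalevskiSq a b s τ by linarith))).1
  have hkC : √(kowalevskiSq a b s τ) ≤ -((a + b) ^ 2 - τ - 2 * s * (a + b)) := by
    have hle : (a + b) ^ 2 - τ - 2 * s * (a + b) ≤ 0 := by linarith
    have : 0 ≤ ((a + b) ^ 2 - τ) * ((s - a) * (s - b)) :=
      mul_nonneg (by linarith) (mul_nonneg (by linarith) (by linarith))
    have := Real.sqrt_le_sqrt (show kowalevskiSq a b s τ ≤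
      ((a + b) ^ 2 - τ - 2 * s * (a + b)) ^ 2 by linarith)
    rwa [Real.sqrt_sq_eq_abs, abs_of_nonpos hle] at this
  have hkD : 0 < s * (a ^ 2 - b ^ 2 - τ) + b * √(kowalevskiSq a b s τ) := by
    rcases lt_or_ge τ (a ^ 2 - b ^ 2) with h | h
    · have := mul_pos hs (sub_pos.2 h)
      have := mul_nonneg hb.le hk0
      linarith
    · have hτB : (a - b) ^ 2 < τ := by nlinarith
      have h1 : 0 < (s ^ 2 - b ^ 2) * ((τ - (a - b) ^ 2) * ((a + b) ^ 2 - τ)) :=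
        mul_pos (by linarith) (mul_pos (by linarith) (by linarith))
      have h2 : (s * (τ - (a ^ 2 - b ^ 2))) ^ 2 < (b * √(kowalevskiSq a b s τ)) ^ 2 := by
        rw [mul_pow b, hk, kowalevskiSq]
        linarith
      have := lt_of_pow_lt_pow_left₀ 2 (mul_nonneg hb.le hk0) h2
      linarith
  generalize √(kowalevskiSq a b s τ) = k at *
  have h0 : 0 < 2 * (s - b) := by linarith
  -- the edge of the triangle opposite to `(a - b, (a - b)²)` meets the line `σ - τ - 2 s x = -k`
  obtain ⟨x, hx⟩ : ∃ x, 2 * (s - b) * x = a ^ 2 - b ^ 2 - τ + k :=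
    ⟨(a ^ 2 - b ^ 2 - τ + k) / (2 * (s - b)), mul_div_cancel₀ _ h0.ne'⟩
  have hx1 : 0 ≤ x := le_of_mul_le_mul_left (by linarith) h0
  have hx2 : x ≤ a + b := le_of_mul_le_mul_left (by linarith) h0
  refine exists_point_axis₂ hs.ne' (by linarith) hx2 (div_pos ?_ (by linarith)) ?_
  · refine pos_of_mul_pos_right (?_ : 0 < (s - b) * _) (by linarith)
    linarith [mul_comm b (2 * (s - b) * x), congrArg (b * ·) hx]
  · refine (mul_eq_zero.1 ?_).resolve_left h0.ne'
    rw [kowalevskiSq] at hk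
    linear_combination
      (1 / 2) * (2 * (s - b) * x - (a ^ 2 - b ^ 2 - τ) + k) * hx + (1 / 2) * hk

/-- There is a point of `𝔒` with `w₁ ≠ 0` over each point of the admissible region off the pendulum
edges. -/
theorem exists_point_of_mem (hb : 0 < b) (hab : b < a)
    (h : (s, τ) ∈ admissibleRegion a b \ pendulumEdges a b) :
    ∃ q ∈ phaseSpace a b, q.w₁ ≠ 0 ∧ q.defect s τ = 0 := by
  obtain ⟨h, hne⟩ := h
  have middle : b ≤ s → s ≤ a → τ < (a + b) ^ 2 →
      ∃ q ∈ phaseSpace a b, q.w₁ ≠ 0 ∧ q.defect s τ = 0 := fun h1 h2 h3 =>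
    exists_point_planar_of_mem rfl (by linarith) (mul_nonneg (by nlinarith) (by nlinarith))
      (by linarith) (div_pos (by linarith) (by linarith))
  have upper : b ≤ s → τ ≤ (a + b) ^ 2 → τ < (a + b) ^ 2 := fun h1 h2 =>
    lt_of_le_of_ne h2 fun h3 => hne (Or.inr ⟨h1, h3⟩)
  rcases h with (((⟨h1, h2, h3⟩ | ⟨h1, h2, h3⟩) | ⟨h1, h2, h3⟩) | ⟨h1, h2, h3⟩) | ⟨h1, h2, h3⟩ <;>
    simp only at h1 h2 h3
  · have hlt : (a - b) ^ 2 < τ := lt_of_le_of_ne h3 fun h4 => hne (Or.inl ⟨h1, h2, h4.symm⟩)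
    exact exists_point_planar_of_mem (b' := -b) (neg_sq b) (by linarith)
      (mul_nonneg (by nlinarith) (by nlinarith)) (by linarith)
      (div_pos_of_neg_of_neg (by linarith) (by linarith))
  · exact exists_point_region₂ hb hab h1 h2 h3
  · exact exists_point_region₃ hb hab h1 h2 h3
  · exact middle h1 h2 (upper h1 h3)
  · have hlt := upper (by linarith) h3
    rcases h1.eq_or_lt with h4 | h4
    · exact middle (by linarith) h4.symm.le hlt
    · exact exists_point_region₅ hb hab h4 h2 hlt

/-! ### Pendulum motions -/

/-- At the pendulum points `K` and `G` depend only on `H` and on the orientation of the pair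
`α`, `β` in the plane of `e₁` and `e₂`. -/
theorem pendulum_integrals (hq : q ∈ phaseSpace a b) (h1 : q.ω₁ = 0) (h2 : q.ω₂ = 0)
    (h3 : q.α₃ = 0) (h4 : q.β₃ = 0) :
    q.K = a ^ 2 + b ^ 2 - 2 * (q.α₁ * q.β₂ - q.α₂ * q.β₁) ∧
    q.G a b = (q.α₁ * q.β₂ - q.α₂ * q.β₁) * q.H := by
  obtain ⟨p1, p2, p3⟩ := hq
  rw [h3] at p1 p3
  rw [h4] at p2
  constructor
  · simp only [State.K, h1, h2]
    linear_combination p1 + p2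
  · simp only [State.G, State.H, Mα, Mβ, Mγ, h1, h2, h3, h4]
    linear_combination q.α₁ * p2 + q.β₂ * p1 - (q.β₁ + q.α₂) * p3

/-- The constants `(s, τ)` attached to a pendulum point with the orientation `b' = ± b`. -/
theorem pendulum_constants {b' h : ℝ} (hb' : b' ^ 2 = b ^ 2) (hs : s ≠ 0)
    (hK : (a - b') ^ 2 =
      (τ ^ 2 - 2 * (a ^ 2 + b ^ 2) * τ + (a ^ 2 - b ^ 2) ^ 2) / (4 * s ^ 2) + τ)
    (hH : h = (a ^ 2 + b ^ 2 - τ) / (2 * s) + s)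
    (hG : a * b' * h = ((a ^ 2 + b ^ 2) ^ 2 - (a ^ 2 - b ^ 2) ^ 2) / (4 * s) +
      (1 / 2) * (a ^ 2 + b ^ 2 - τ) * s) :
    τ = (a - b') ^ 2 ∧ s * h = s ^ 2 + a * b' := by
  have hτ : τ = (a - b') ^ 2 := by
    rw [← hb'] at hK hH hG
    rw [hH] at hG
    field_simp at hG hK
    have hK' : (τ - (a - b') ^ 2) * (τ - (a + b') ^ 2 + 4 * s ^ 2) = 0 := by
      linear_combination -hK
    have hG' : (s ^ 2 - a * b') * (τ - (a - b') ^ 2) = 0 := by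
      linear_combination (1 / 4) * hG
    rcases mul_eq_zero.1 hG' with h1 | h1
    · have : (τ - (a - b') ^ 2) ^ 2 = 0 := by
        linear_combination hK' - 4 * (τ - (a - b') ^ 2) * h1
      exact sub_eq_zero.1 (pow_eq_zero_iff two_ne_zero |>.1 this)
    · exact sub_eq_zero.1 h1
  refine ⟨hτ, ?_⟩
  rw [hH, hτ, ← hb']
  field_simp
  ring

theorem mem_admissibleRegion_sub_sq (hb : 0 < b) (hab : b < a)
    (h : s < 0 ∧ (s + a) * (s + b) ≤ 0 ∨ 0 < s) :
    (s, (a - b) ^ 2) ∈ admissibleRegion a b := by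
  have ha : 0 < a := hb.trans hab
  have hτ : (a - b) ^ 2 ≤ (a + b) ^ 2 := by linarith [mul_pos ha hb]
  rcases h with ⟨hneg, hle⟩ | hpos
  · have h1 : -a ≤ s := by
      by_contra! hlt
      linarith [mul_pos_of_neg_of_neg (by linarith : s + a < 0) (by linarith : s + b < 0)]
    have h2 : s ≤ -b := by
      by_contra! hlt
      linarith [mul_pos (by linarith : 0 < s + a) (by linarith : 0 < s + b)]
    exact Or.inl (Or.inl (Or.inl (Or.inl ⟨h1, h2, le_rfl⟩)))
  · rcases le_total s b with hsb | hsb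
    · refine Or.inl (Or.inl (Or.inr ⟨hpos, hsb, ?_⟩))
      have hsb2 : s ^ 2 ≤ b ^ 2 := pow_le_pow_left₀ hpos.le hsb 2
      have hab2 : b ^ 2 ≤ a ^ 2 := pow_le_pow_left₀ hb.le hab.le 2
      have hu := Real.sq_sqrt (show 0 ≤ a ^ 2 - s ^ 2 by linarith)
      have hv := Real.sq_sqrt (show 0 ≤ b ^ 2 - s ^ 2 by linarith)
      have huv : √(a ^ 2 - s ^ 2) * √(b ^ 2 - s ^ 2) ≤ a * b - s ^ 2 := by
        rw [← Real.sqrt_mul (by linarith)]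
        refine Real.sqrt_le_iff.2 ⟨?_, ?_⟩
        · linarith [mul_le_mul_of_nonneg_right hab.le hb.le]
        · linarith [sq_nonneg (s * (a - b))]
      simp only
      linarith
    rcases le_total s a with hsa | hsa
    · exact Or.inl (Or.inr ⟨hsb, hsa, hτ⟩)
    · exact Or.inr ⟨hsa, (neg_nonpos.2 (sq_nonneg _)).trans (sq_nonneg _), hτ⟩

theorem mem_admissibleRegion_add_sq (hb : 0 < b) (hab : b < a)
    (h : s < 0 ∧ (s + a) * (s - b) ≤ 0 ∨ 0 < s ∧ 0 ≤ (s + a) * (s - b)) :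
    (s, (a + b) ^ 2) ∈ admissibleRegion a b := by
  have ha : 0 < a := hb.trans hab
  rcases h with ⟨hneg, hle⟩ | ⟨hpos, hle⟩
  · have h1 : -a ≤ s := by
      by_contra! hlt
      linarith [mul_pos_of_neg_of_neg (by linarith : s + a < 0) (by linarith : s - b < 0)]
    rcases le_total s (-b) with hsb | hsb
    · exact Or.inl (Or.inl (Or.inl (Or.inl
        ⟨h1, hsb, by simp only; linarith [mul_pos ha hb]⟩)))
    · refine Or.inl (Or.inl (Or.inl (Or.inr ⟨hsb, hneg, ?_⟩)))
      have hu : √(a ^ 2 - s ^ 2) ≤ a := Real.sqrt_le_iff.2 ⟨ha.le, by linarith [sq_nonneg s]⟩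
      have hv : √(b ^ 2 - s ^ 2) ≤ b := Real.sqrt_le_iff.2 ⟨hb.le, by linarith [sq_nonneg s]⟩
      exact pow_le_pow_left₀ (by positivity) (add_le_add hu hv) 2
  · have hsb : b ≤ s := by
      by_contra! hlt
      linarith [mul_neg_of_pos_of_neg (by linarith : 0 < s + a) (by linarith : s - b < 0)]
    rcases le_total s a with hsa | hsa
    · exact Or.inl (Or.inr ⟨hsb, hsa, le_rfl⟩)
    · exact Or.inr ⟨hsa, (neg_nonpos.2 (sq_nonneg _)).trans (sq_nonneg _), le_rfl⟩

theorem mem_admissibleRegion_of_pendulum (hb : 0 < b) (hab : b < a)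
    (hq : q ∈ pendulumPart a b s τ) : (s, τ) ∈ admissibleRegion a b := by
  obtain ⟨hP, hw, hz, hs, hH, hK, hG⟩ := hq
  obtain ⟨h1, h2⟩ := (w₁_eq_zero_iff q).1 hw
  obtain ⟨h3, h4⟩ := (z₁_eq_zero_iff q).1 hz
  obtain ⟨iK, iG⟩ := pendulum_integrals hP h1 h2 h3 h4
  have hγ := cross_third_sq hP
  rw [h3, h4] at hγ
  have hHge : -(q.α₁ + q.β₂) ≤ q.H := by
    rw [State.H, h1, h2]
    linarith [sq_nonneg q.ω₃]
  have hY : (q.α₁ + q.β₂) ^ 2 ≤ a ^ 2 + b ^ 2 + 2 * (q.α₁ * q.β₂ - q.α₂ * q.β₁) := by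
    obtain ⟨p1, p2, -⟩ := hP
    rw [h3] at p1
    rw [h4] at p2
    linarith [sq_nonneg (q.α₂ - q.β₁)]
  rw [iK] at hK
  rw [iG] at hG
  have key : ∀ b' : ℝ, b' ^ 2 = b ^ 2 → 0 ≤ a + b' → q.α₁ * q.β₂ - q.α₂ * q.β₁ = a * b' →
      τ = (a - b') ^ 2 ∧ s * q.H = s ^ 2 + a * b' ∧ -(a + b') ≤ q.H := by
    intro b' hb' hpos hg
    rw [hg] at hK hG hY
    obtain ⟨c1, c2⟩ := pendulum_constants hb' hs (by rw [← hK]; linear_combination hb') hH hG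
    have : q.α₁ + q.β₂ ≤ a + b' := abs_le_of_sq_le_sq' (by linarith) hpos |>.2
    exact ⟨c1, c2, by linarith⟩
  have hcases : q.α₁ * q.β₂ - q.α₂ * q.β₁ = a * b ∨ q.α₁ * q.β₂ - q.α₂ * q.β₁ = a * -b := by
    have : (q.α₁ * q.β₂ - q.α₂ * q.β₁) ^ 2 = (a * b) ^ 2 := by linarith
    rcases sq_eq_sq_iff_eq_or_eq_neg.1 this with h | h
    · exact Or.inl h
    · exact Or.inr (by linarith)
  rcases hcases with hg | hg
  · obtain ⟨rfl, c2, c3⟩ := key b rfl (by linarith) hg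
    refine mem_admissibleRegion_sub_sq hb hab ?_
    rcases hs.lt_or_gt with hneg | hpos
    · exact Or.inl ⟨hneg, by linarith [mul_le_mul_of_nonpos_left c3 hneg.le]⟩
    · exact Or.inr hpos
  · obtain ⟨rfl, c2, c3⟩ := key (-b) (neg_sq b) (by linarith) hg
    rw [sub_neg_eq_add]
    refine mem_admissibleRegion_add_sq hb hab ?_
    rcases hs.lt_or_gt with hneg | hpos
    · exact Or.inl ⟨hneg, by linarith [mul_le_mul_of_nonpos_left c3 hneg.le]⟩
    · exact Or.inr ⟨hpos, by linarith [mul_le_mul_of_nonneg_left c3 hpos.le]⟩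

/-- A pendulum motion with `τ = (a - b')²`, where `b' = ± b` is the orientation. It starts with `α`
along `e₁` and `β` along `b' e₂`, where the potential energy is least. -/
theorem exists_pendulumMotion (ha : 0 ≤ a) (hb : 0 ≤ b) {b' : ℝ} (hb' : b' ^ 2 = b ^ 2)
    (hs : s ≠ 0) (hE : 0 ≤ a * b' / s + s + (a + b')) :
    ∃ ζ, IsPendulumMotion a b s ((a - b') ^ 2) ζ := by
  have hω := Real.sq_sqrt (mul_nonneg zero_le_two hE)
  generalize √(2 * (a * b' / s + s + (a + b'))) = ω at hω
  have hq : (⟨0, 0, ω, a, 0, 0, 0, b', 0⟩ : State) ∈ phaseSpace a b :=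
    ⟨by simp, by simpa using hb', by simp⟩
  obtain ⟨ζ, hζ, h0⟩ := exists_motion ha hb hq
  refine ⟨ζ, hζ, fun t => ?_⟩
  have hinv := hζ.1.pendulum_invariant (by rw [h0]) (by rw [h0]) (by rw [h0]) (by rw [h0])
  obtain ⟨h1, h2, h3, h4⟩ := hinv t
  obtain ⟨iK, iG⟩ := pendulum_integrals (hζ.2 t) h1 h2 h3 h4
  have hγ : (ζ t).α₁ * (ζ t).β₂ - (ζ t).α₂ * (ζ t).β₁ = a * b' := by
    rw [eq_of_hasDerivAt_zero
      (f := fun t => (ζ t).α₁ * (ζ t).β₂ - (ζ t).α₂ * (ζ t).β₁) ?_ t 0]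
    · simp [h0]
    · intro u
      obtain ⟨g1, g2, g3, g4⟩ := hinv u
      refine HasDerivAt.congr_deriv (((hζ.1.hα₁ u).mul (hζ.1.hβ₂ u)).sub
        ((hζ.1.hα₂ u).mul (hζ.1.hβ₁ u))) ?_
      simp only [g1, g2]
      ring
  have hH : (ζ t).H = a * b' / s + s := by
    rw [hζ.1.H_eq t 0, h0, State.H]
    simp only
    linear_combination (1 / 2) * hω
  refine ⟨hζ.2 t, (w₁_eq_zero_iff _).2 ⟨h1, h2⟩, (z₁_eq_zero_iff _).2 ⟨h3, h4⟩, hs, ?_, ?_, ?_⟩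
  · rw [hH, ← hb']
    field_simp
    ring
  · rw [iK, hγ, ← hb']
    field_simp
    ring
  · rw [iG, hγ, hH, ← hb']
    field_simp
    ring

theorem exists_pendulumMotion_of_mem (hb : 0 < b) (hab : b < a)
    (h : (s, τ) ∈ pendulumEdges a b) : ∃ ζ, IsPendulumMotion a b s τ ζ := by
  rcases h with ⟨h1, h2, h3⟩ | ⟨h1, h3⟩ <;> simp only at h1 h3 <;> subst h3
  · simp only at h2
    refine exists_pendulumMotion (by linarith) hb.le rfl (by linarith) ?_
    have hs : s < 0 := by linarith
    have : a * b / s + s + (a + b) = (s + a) * (-s - b) / -s := by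
      field_simp [hs.ne]
      ring
    rw [this]
    exact div_nonneg (mul_nonneg (by linarith) (by linarith)) (by linarith)
  · rw [← sub_neg_eq_add]
    have hs : 0 < s := by linarith
    refine exists_pendulumMotion (by linarith) hb.le (neg_sq b) hs.ne' ?_
    have : a * -b / s + s + (a + -b) = (s + a) * (s - b) / s := by
      field_simp
      ring
    rw [this]
    exact div_nonneg (mul_nonneg (by linarith) (by linarith)) hs.le

/-! ### Regular motions -/

theorem exists_regularMotion (ha : 0 ≤ a) (hb : 0 ≤ b) (hq : q ∈ phaseSpace a b)
    (hw : q.w₁ ≠ 0) (h : q.defect s τ = 0) : ∃ ζ, IsRegularMotion a b s τ ζ := by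
  obtain ⟨ζ, hζ, h0⟩ := exists_motion ha hb hq
  have hinv := hζ.defect_invariant (s := s) (τ := τ)
    (by rw [h0]; exact (integrals_of_defect hq hw h).1) (by rw [h0]; exact h)
  exact ⟨ζ, hζ, ⟨0, by rwa [h0]⟩, fun t ht => (regular_iff_defect (hζ.2 t) ht).2 (hinv t)⟩

theorem J_mem_of_regular (hb : 0 < b) (hab : b < a) (hq : q ∈ regularPart a b) :
    J a b q ∈ admissibleRegion a b \ pendulumEdges a b :=
  mem_admissibleRegion_of_defect hb hab hq.1 hq.2.1
    ((regular_iff_defect hq.1 hq.2.1).1 ⟨hq, rfl⟩)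

end KowalevskiTop

theorem theorem4 (a b : ℝ) (hb : 0 < b) (hab : b < a) :
    (∀ s τ : ℝ,
      (∃ ζ : ℝ → KowalevskiTop.State,
        KowalevskiTop.IsRegularMotion a b s τ ζ ∨ KowalevskiTop.IsPendulumMotion a b s τ ζ) ↔
      (s, τ) ∈ KowalevskiTop.admissibleRegion a b) ∧
    (∀ s τ : ℝ,
      (KowalevskiTop.integralManifold a b s τ).Nonempty ↔
      (s, τ) ∈ KowalevskiTop.admissibleRegion a b) ∧
    (∀ s τ : ℝ,
      (∃ ζ : ℝ → KowalevskiTop.State, KowalevskiTop.IsRegularMotion a b s τ ζ) ↔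
      (s, τ) ∈ KowalevskiTop.admissibleRegion a b \ KowalevskiTop.pendulumEdges a b) ∧
    KowalevskiTop.J a b '' KowalevskiTop.regularPart a b =
      KowalevskiTop.admissibleRegion a b \ KowalevskiTop.pendulumEdges a b := by
  open KowalevskiTop in
  have ha : 0 < a := hb.trans hab
  have regular_mem : ∀ {s τ ζ}, IsRegularMotion a b s τ ζ →
      (s, τ) ∈ admissibleRegion a b \ pendulumEdges a b := by
    rintro s τ ζ ⟨-, ⟨t, ht⟩, h⟩
    obtain ⟨hq, hJ⟩ := h t ht
    exact hJ ▸ J_mem_of_regular hb hab hq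
  have exists_regular : ∀ {s τ}, (s, τ) ∈ admissibleRegion a b \ pendulumEdges a b →
      ∃ ζ, IsRegularMotion a b s τ ζ := by
    intro s τ h
    obtain ⟨q, hq, hw, hd⟩ := exists_point_of_mem hb hab h
    exact exists_regularMotion ha.le hb.le hq hw hd
  have exists_any : ∀ {s τ}, (s, τ) ∈ admissibleRegion a b →
      ∃ ζ, IsRegularMotion a b s τ ζ ∨ IsPendulumMotion a b s τ ζ := by
    intro s τ h
    by_cases he : (s, τ) ∈ pendulumEdges a b
    · obtain ⟨ζ, hζ⟩ := exists_pendulumMotion_of_mem hb hab he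
      exact ⟨ζ, Or.inr hζ⟩
    · obtain ⟨ζ, hζ⟩ := exists_regular ⟨h, he⟩
      exact ⟨ζ, Or.inl hζ⟩
  refine ⟨fun s τ => ⟨?_, exists_any⟩, fun s τ => ⟨?_, fun h => ?_⟩,
    fun s τ => ⟨fun ⟨ζ, hζ⟩ => regular_mem hζ, exists_regular⟩, ?_⟩
  · rintro ⟨ζ, hζ | hζ⟩
    · exact (regular_mem hζ).1
    · exact mem_admissibleRegion_of_pendulum hb hab (hζ.2 0)
  · rintro ⟨q, ⟨hq, hJ⟩ | hq⟩
    · have h := J_mem_of_regular hb hab hq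
      rw [hJ] at h
      exact h.1
    · exact mem_admissibleRegion_of_pendulum hb hab hq
  · obtain ⟨ζ, ⟨-, ⟨t, ht⟩, hζ⟩ | hζ⟩ := exists_any h
    · exact ⟨ζ t, Or.inl (hζ t ht)⟩
    · exact ⟨ζ 0, Or.inr (hζ.2 0)⟩
  · ext ⟨s, τ⟩
    constructor
    · rintro ⟨q, hq, hJ⟩
      exact hJ ▸ J_mem_of_regular hb hab hq
    · intro h
      obtain ⟨q, hq, hw, hd⟩ := exists_point_of_mem hb hab h
      obtain ⟨h1, h2⟩ := (regular_iff_defect hq hw).2 hd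
      exact ⟨q, h1, h2⟩
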